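/- Let $\lambda\in\mathbb C$, $|\lambda|<1$. Every $x\in[-1,1]$ has a signed binary expansion $x=\sum_{n\ge0}x_n2^{-n-1}$ with $x_n\in\{-1,+1\}$, unique except at countably many dyadic rationals, where one expansion is chosen. Put $$V(x)=1+\sum_{n=0}^{\infty}\lambda^{n+1}L_n(x),\qquad L_n(x)=\begin{cases}1,&x_0+\dots+x_n=0,\\0,&\text{otherwise.}\end{cases}$$ All square roots are principal, empty sums are $0$, and empty products and empty determinants are $1$. **(i)** Let $P(x)=\sum_{n=0}^Np_nx^n$ with $N\ge0$, $p_n\in\mathbb C$. For $k\ge1$ and $m\ge0$ put $$a_{k,m}=\begin{cases}1,&m=0,\\ \binom km\dfrac{\lambda^{2m}}{1+\sqrt{1-\lambda^{2m}}},&1\le m<k,\\ -\sqrt{1-\lambda^{2k}},&m=k,\\ 0,&m>k.\end{cases}$$ Then $P(V)$ is integrable on $[-1,1]$ and $$\int_{-1}^1P(V(x))\,dx=\frac{2}{\prod_{n=1}^N\sqrt{1-\lambda^{2n}}}\det A_P,$$ where $A_P$ is the $(N+1)\times(N+1)$ matrix with rows $(a_{k,0},\dots,a_{k,N})$, $k=1,\dots,N$,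 followed by the row $(p_0,\dots,p_N)$. In particular, for $N\ge0$, $$\int_{-1}^1V(x)^N\,dx=\frac{2}{\prod_{n=1}^N\sqrt{1-\lambda^{2n}}}\det\bigl(a_{k,m}\bigr)_{1\le k\le N,\ 0\le m\le N-1}.$$ Moreover, for $N\ge1$, $$\int_{-1}^1V(x)^N\,dx=\frac1{\sqrt{1-\lambda^{2N}}}\Bigl(2+\sum_{n=1}^{N-1}\binom Nn\bigl(1-\sqrt{1-\lambda^{2n}}\bigr)\int_{-1}^1V(x)^n\,dx\Bigr).$$ **(ii)** Let $X$ be one of the complex spaces $L^2(-1,1)$, $L^\infty(-1,1)$, $C([-1,1])$, and let $(\mathcal R_\pm h)(x)=h\bigl(\frac{x\pm1}2\bigr)$ on $X$. For $|z|=1$ the operator norm satisfies $\|z^{-1}\mathcal R_-+z\mathcal R_+\|_{X\to X}\le2$, the operator $1-\lambda\frac{z^{-1}\mathcal R_-+z\mathcal R_+}2$ is invertible on $X$, and for every $h\in X$ $$\int_{-1}^1V(x)h(x)\,dx=\int_{-1}^1\oint_{|z|=1}\Bigl(1-\lambda\frac{z^{-1}\mathcal R_-+z\mathcal R_+}2\Bigr)^{-1}h(x)\,\frac{dz}{2\pi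 iz}\,dx.$$ The inner integral is pointwise in $x$ for $X=C([-1,1])$; for $X=L^2,L^\infty$ it is the Bochner integral of an $X$-valued function, and then the identity also holds with the two integrations interchanged. **(iii)** Let $N\ge0$ be even and $P(x)=\sum_{n=0}^Np_nx^n$ with $p_n\in\mathbb C$. For $0\le j\le N$ put $s_j=\sqrt{1-\lambda^2/4^j}$, and for $0\le k,m\le N$ $$b^{(j)}_{k,m}=\begin{cases}\binom km,&m<k,\ k-m\text{ even},\\-\binom km s_j,&m<k,\ k-m\text{ odd},\\1-\frac{2^k}{2^j},&m=k,\\0,&m>k,\end{cases}\qquad c_k=\begin{cases}\frac{2^k}{k+1},&k\text{ even},\\0,&k\text{ odd}.\end{cases}$$ Then $$\int_{-1}^1V(x)P(x)\,dx=\sum_{j=0}^N\frac{2}{2^js_j\prod_{0\le n\le N,\,n\ne j}\bigl(1-\frac{2^n}{2^j}\bigr)}\det B_j,$$ where $B_j$ is the $(N+2)\times(N+2)$ matrix with rows $(b^{(j)}_{k,0},\dots,b^{(j)}_{k,N},c_k)$, $k=0,\dots,N$, followed by the row $(-p_0,\dots,-p_N,0)$. In particular $$\int_{-1}^1V(x)x^N\,dx=\sum_{j=0}^N\frac{2}{2^js_j\prod_{0\le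 n\le N,\,n\ne j}\bigl(1-\frac{2^n}{2^j}\bigr)}\det B_j',$$ where $B'_j$ is the $(N+1)\times(N+1)$ matrix with rows $(b^{(j)}_{k,0},\dots,b^{(j)}_{k,N-1},c_k)$, $k=0,\dots,N$. If $N\ge0$ is odd, then $\int_{-1}^1V(x)x^N\,dx=0$. **(iv)** For every $\omega\in\mathbb C$, $$\int_{-1}^1V(x)\cos(\omega x)\,dx=\frac1\pi\int_{-\pi}^{\pi}C(\varphi,\omega)\,d\varphi,\qquad C(\varphi,\omega)=\sum_{n=0}^\infty\lambda^n\,\frac{2^n}\omega\sin\frac\omega{2^n}\prod_{j=1}^n\cos\Bigl(\varphi+\frac\omega{2^j}\Bigr),$$ where the series converges for all $\varphi\in\mathbb R$, $C(\cdot,\omega)$ is integrable on $[-\pi,\pi]$, and for $\omega=0$ the expressions $\frac{2^n}\omega\sin\frac\omega{2^n}$ and $\frac{\sin\omega}{\omega}$ are replaced by their limit $1$. If $\omega\notin\pi\mathbb Z\setminus\{0\}$ and $\varphi\in\mathbb R$, then, with $\gamma_j=\cos\frac\omega{2^j}$ and $\delta_j=\lambda\cos\bigl(\varphi+\frac\omega{2^j}\bigr)$,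 $$C(\varphi,\omega)=\frac{\sin\omega}\omega\cdot\cfrac1{1-\cfrac{\delta_1}{\gamma_1+\delta_1-\cfrac{\gamma_1\delta_2}{\gamma_2+\delta_2-\cfrac{\gamma_2\delta_3}{\gamma_3+\delta_3-\cdots}}}}.$$ Here the continued fraction is the limit of its convergents $A_n/B_n$, with $A_n,B_n$ given by the usual three-term recurrences, and all $B_n\ne0$. -/

import Mathlib

open MeasureTheory Filter Topology Complex

noncomputable section

/-! ### Signed binary digits and the function `V` -/

/-- The remainders of the signed binary expansion: `signedRem x 0 = x`, and the left shift of
digits sends a remainder `y` to `2 * y - 1` if `0 < y` and to `2 * y + 1` if `y ≤ 0`. -/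
def signedRem (x : ℝ) : ℕ → ℝ
  | 0 => x
  | n + 1 => if 0 < signedRem x n then 2 * signedRem x n - 1 else 2 * signedRem x n + 1

/-- The signed binary digits `x_n ∈ {-1, 1}` of `x ∈ [-1, 1]`, `x = ∑ x_n / 2 ^ (n + 1)`. At the
dyadic rationals with two expansions one of them is chosen. -/
def signedDigit (x : ℝ) (n : ℕ) : ℤ := if 0 < signedRem x n then 1 else -1

theorem signedRem_abs_le {x : ℝ} (hx : |x| ≤ 1) (n : ℕ) : |signedRem x n| ≤ 1 := by
  induction n with
  | zero => exact hx
  | succ n ih =>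
    rw [abs_le] at ih ⊢
    rw [signedRem]
    split_ifs with h
    · constructor <;> linarith [ih.1, ih.2]
    · constructor <;> linarith [ih.1, ih.2]

theorem sum_signedDigit (x : ℝ) (n : ℕ) :
    ∑ k ∈ Finset.range n, (signedDigit x k : ℝ) / 2 ^ (k + 1) = x - signedRem x n / 2 ^ n := by
  induction n with
  | zero => simp [signedRem]
  | succ n ih =>
    rw [Finset.sum_range_succ, ih, signedRem, signedDigit]
    split_ifs <;> (push_cast; field_simp; ring)

/-- The digits are those of a signed binary expansion of `x`. -/
theorem hasSum_signedDigit {x : ℝ} (hx : |x| ≤ 1) :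
    HasSum (fun n : ℕ => (signedDigit x n : ℝ) / 2 ^ (n + 1)) x := by
  have hg : Summable (fun n : ℕ => (1 / 2 : ℝ) ^ (n + 1)) :=
    (summable_nat_add_iff 1).2 summable_geometric_two
  have hs : Summable (fun n : ℕ => (signedDigit x n : ℝ) / 2 ^ (n + 1)) := by
    refine Summable.of_norm_bounded hg fun n => ?_
    rw [signedDigit]
    split_ifs <;> simp
  have ht : Tendsto (fun n : ℕ => x - signedRem x n / 2 ^ n) atTop (𝓝 (x - 0)) := by
    refine tendsto_const_nhds.sub ?_
    refine squeeze_zero_norm (a := fun n : ℕ => (1 / 2 : ℝ) ^ n) (fun n => ?_)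
      (tendsto_pow_atTop_nhds_zero_of_lt_one (by norm_num) (by norm_num))
    rw [norm_div, Real.norm_eq_abs, norm_pow, Real.norm_ofNat, one_div, inv_pow, ← one_div]
    gcongr
    exact signedRem_abs_le hx n
  have h2 := hs.hasSum.tendsto_sum_nat
  simp_rw [sum_signedDigit] at h2
  have := tendsto_nhds_unique h2 ht
  rw [sub_zero] at this
  have h3 := hs.hasSum
  rwa [this] at h3

/-- `V(x) = 1 + ∑ λ ^ (n + 1) L_n(x)`, where `L_n(x) = 1` if `x_0 + ⋯ + x_n = 0`, and `0`
otherwise. -/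
def returnV (lam : ℂ) (x : ℝ) : ℂ :=
  1 + ∑' n : ℕ, lam ^ (n + 1) * (if ∑ j ∈ Finset.range (n + 1), signedDigit x j = 0 then 1 else 0)

/-! ### The determinants for `∫ P(V(x)) dx` -/

/-- The entry in column `m = 0, 1, …` of the row with number `k = 1, 2, …`. -/
def powEntry (lam : ℂ) (k m : ℕ) : ℂ :=
  if m = 0 then 1
  else if m < k then (k.choose m : ℂ) * lam ^ (2 * m) / (1 + Complex.sqrt (1 - lam ^ (2 * m)))
  else if m = k then -Complex.sqrt (1 - lam ^ (2 * k))
  else 0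

/-- Rows `k = 1, …, N`, followed by the row `p_0, …, p_N`. -/
def powMatrix (lam : ℂ) (N : ℕ) (p : ℕ → ℂ) : Matrix (Fin (N + 1)) (Fin (N + 1)) ℂ :=
  Matrix.of fun i m => if (i : ℕ) = N then p m else powEntry lam (i + 1) m

/-- Rows `k = 1, …, N`, columns `m = 0, …, N - 1`. -/
def powMatrix' (lam : ℂ) (N : ℕ) : Matrix (Fin N) (Fin N) ℂ :=
  Matrix.of fun i m => powEntry lam (i + 1) m

/-! ### The determinants for `∫ V(x) P(x) dx` -/

/-- The square root `√(1 - λ² / 4 ^ j)`. -/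
def sqrtJ (lam : ℂ) (j : ℕ) : ℂ := Complex.sqrt (1 - lam ^ 2 / 4 ^ j)

/-- The entry in row `k` and column `m` of the lower triangular part. -/
def momEntry (lam : ℂ) (j k m : ℕ) : ℂ :=
  if m < k then
    if Even (k + m) then (k.choose m : ℂ) else -(k.choose m : ℂ) * sqrtJ lam j
  else if m = k then 1 - 2 ^ k / 2 ^ j
  else 0

/-- The entry in row `k` of the last column: `1, 0, 2² / 3, 0, …`. -/
def momLast (k : ℕ) : ℂ := if Even k then 2 ^ k / ((k : ℂ) + 1) else 0

/-- Rows `k = 0, …, N` with the column `momLast` appended, followed by the row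
`-p_0, …, -p_N, 0`. -/
def momMatrix (lam : ℂ) (N j : ℕ) (p : ℕ → ℂ) : Matrix (Fin (N + 2)) (Fin (N + 2)) ℂ :=
  Matrix.of fun i m =>
    if (i : ℕ) = N + 1 then (if (m : ℕ) = N + 1 then 0 else -p m)
    else if (m : ℕ) = N + 1 then momLast i
    else momEntry lam j i m

/-- Rows `k = 0, …, N`; columns `m = 0, …, N - 1` followed by the column `momLast`. -/
def momMatrix' (lam : ℂ) (N j : ℕ) : Matrix (Fin (N + 1)) (Fin (N + 1)) ℂ :=
  Matrix.of fun i m => if (m : ℕ) = N then momLast i else momEntry lam j i m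

/-- The factor in front of the `j`-th determinant. -/
def momFactor (lam : ℂ) (N j : ℕ) : ℂ :=
  2 / (2 ^ j * sqrtJ lam j * ∏ n ∈ (Finset.range (N + 1)).erase j, (1 - 2 ^ n / 2 ^ j))

/-! ### The operators `R_±` on `L^p(-1, 1)` and on `C([-1, 1])` -/

/-- Lebesgue measure on `(-1, 1)`. -/
def muI : Measure ℝ := volume.restrict (Set.Ioo (-1) 1)

theorem map_muI_le {e : ℝ} (he : |e| ≤ 1) :
    Measure.map (fun x : ℝ => (x + e) / 2) muI ≤ (2 : ENNReal) • muI := by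
  have hm : Measurable (fun x : ℝ => (x + e) / 2) := by fun_prop
  rw [abs_le] at he
  refine Measure.le_iff.2 fun s hs => ?_
  rw [Measure.map_apply hm hs, muI, Measure.restrict_apply (hm hs), Measure.smul_apply,
    Measure.restrict_apply hs, smul_eq_mul]
  have h1 : (fun x : ℝ => (x + e) / 2) ⁻¹' s ∩ Set.Ioo (-1) 1 ⊆
      (fun x : ℝ => x + e) ⁻¹' ((fun x : ℝ => x * 2⁻¹) ⁻¹' (s ∩ Set.Ioo (-1) 1)) := by
    rintro x ⟨hx, hx1, hx2⟩
    simp only [Set.mem_preimage, Set.mem_inter_iff, Set.mem_Ioo, ← div_eq_mul_inv] at hx ⊢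
    exact ⟨hx, by linarith, by linarith⟩
  refine (measure_mono h1).trans ?_
  rw [measure_preimage_add_right, Real.volume_preimage_mul_right (by norm_num)]
  simp

theorem memLp_comp_affine {p : ENNReal} {e : ℝ} (he : |e| ≤ 1) {f : ℝ → ℂ} (hf : MemLp f p muI) :
    MemLp (fun x : ℝ => f ((x + e) / 2)) p muI :=
  (hf.of_measure_le_smul (by simp) (map_muI_le he)).comp_of_map (by fun_prop)

theorem affine_quasi {e : ℝ} (he : |e| ≤ 1) :
    Measure.QuasiMeasurePreserving (fun x : ℝ => (x + e) / 2) muI muI :=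
  ⟨by fun_prop, Measure.absolutelyContinuous_of_le_smul (map_muI_le he)⟩

/-- The bounded operator `h ↦ h((x + e) / 2)` on `L^p(-1, 1)`, for `|e| ≤ 1`. -/
def affineLp (p : ENNReal) [Fact (1 ≤ p)] (e : ℝ) (he : |e| ≤ 1) : Lp ℂ p muI →L[ℂ] Lp ℂ p muI :=
  LinearMap.mkContinuous
    { toFun := fun h => (memLp_comp_affine he (Lp.memLp h)).toLp
      map_add' := fun f g => by
        rw [← MemLp.toLp_add]
        exact MemLp.toLp_congr _ _ ((affine_quasi he).ae_eq_comp (Lp.coeFn_add f g))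
      map_smul' := fun c f => by
        rw [RingHom.id_apply, ← MemLp.toLp_const_smul]
        exact MemLp.toLp_congr _ _ ((affine_quasi he).ae_eq_comp (Lp.coeFn_smul c f)) }
    ((2 : ENNReal) ^ (1 / p).toReal).toReal
    (fun h => by
      have hm : AEMeasurable (fun x : ℝ => (x + e) / 2) muI := by fun_prop
      have hs : AEStronglyMeasurable h (Measure.map (fun x : ℝ => (x + e) / 2) muI) :=
        ((Lp.memLp h).of_measure_le_smul (by simp) (map_muI_le he)).1
      have h1 : eLpNorm (fun x : ℝ => h ((x + e) / 2)) p muI ≤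
          (2 : ENNReal) ^ (1 / p).toReal * eLpNorm h p muI := by
        have := eLpNorm_le_of_measure_le_smul (map_muI_le he) (f := h) (p := p)
        rwa [eLpNorm_map_measure hs hm] at this
      change ‖(memLp_comp_affine he (Lp.memLp h)).toLp‖ ≤ _
      rw [Lp.norm_toLp, Lp.norm_def, ← ENNReal.toReal_mul]
      refine ENNReal.toReal_mono ?_ h1
      exact ENNReal.mul_ne_top (by simp) (Lp.eLpNorm_ne_top h))

theorem affineLp_coeFn (p : ENNReal) [Fact (1 ≤ p)] (e : ℝ) (he : |e| ≤ 1) (h : Lp ℂ p muI) :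
    affineLp p e he h =ᵐ[muI] fun x => h ((x + e) / 2) :=
  MemLp.coeFn_toLp (memLp_comp_affine he (Lp.memLp h))

/-- `(R_+ h)(x) = h((x + 1) / 2)` on `L^p(-1, 1)`. -/
def RplusLp (p : ENNReal) [Fact (1 ≤ p)] : Lp ℂ p muI →L[ℂ] Lp ℂ p muI :=
  affineLp p 1 (by simp)

/-- `(R_- h)(x) = h((x - 1) / 2)` on `L^p(-1, 1)`. -/
def RminusLp (p : ENNReal) [Fact (1 ≤ p)] : Lp ℂ p muI →L[ℂ] Lp ℂ p muI :=
  affineLp p (-1) (by simp)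

/-- `z⁻¹ R_- + z R_+` on `L^p(-1, 1)`. -/
def transferLp (p : ENNReal) [Fact (1 ≤ p)] (z : ℂ) : Lp ℂ p muI →L[ℂ] Lp ℂ p muI :=
  z⁻¹ • RminusLp p + z • RplusLp p

/-- The self-map `x ↦ (x + e) / 2` of `[-1, 1]`, for `|e| ≤ 1`. -/
def affineIcc (e : ℝ) (he : |e| ≤ 1) : C(Set.Icc (-1 : ℝ) 1, Set.Icc (-1 : ℝ) 1) where
  toFun x := ⟨((x : ℝ) + e) / 2, by
    have h1 := x.2.1
    have h2 := x.2.2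
    rw [abs_le] at he
    constructor <;> linarith [he.1, he.2]⟩
  continuous_toFun := by fun_prop

/-- The bounded operator `h ↦ h((x + e) / 2)` on `C([-1, 1])`, for `|e| ≤ 1`. -/
def affineC (e : ℝ) (he : |e| ≤ 1) :
    C(Set.Icc (-1 : ℝ) 1, ℂ) →L[ℂ] C(Set.Icc (-1 : ℝ) 1, ℂ) where
  toLinearMap := (ContinuousMap.compRightAlgHom ℂ ℂ (affineIcc e he)).toLinearMap
  cont := ContinuousMap.continuous_precomp _

/-- `(R_+ h)(x) = h((x + 1) / 2)` on `C([-1, 1])`. -/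
def RplusC : C(Set.Icc (-1 : ℝ) 1, ℂ) →L[ℂ] C(Set.Icc (-1 : ℝ) 1, ℂ) := affineC 1 (by simp)

/-- `(R_- h)(x) = h((x - 1) / 2)` on `C([-1, 1])`. -/
def RminusC : C(Set.Icc (-1 : ℝ) 1, ℂ) →L[ℂ] C(Set.Icc (-1 : ℝ) 1, ℂ) := affineC (-1) (by simp)

/-- `z⁻¹ R_- + z R_+` on `C([-1, 1])`. -/
def transferC (z : ℂ) : C(Set.Icc (-1 : ℝ) 1, ℂ) →L[ℂ] C(Set.Icc (-1 : ℝ) 1, ℂ) :=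
  z⁻¹ • RminusC + z • RplusC

/-! ### The Fourier transform of `V` -/

/-- `sin w / w`, with the value `1` at `w = 0`. -/
def csinc (w : ℂ) : ℂ := if w = 0 then 1 else Complex.sin w / w

/-- The `n`-th term of the series for `C(φ, ω)`. Here `csinc (ω / 2 ^ n)` is
`(2 ^ n / ω) sin (ω / 2 ^ n)`, with the limit value `1` at `ω = 0`. -/
def fourierTerm (lam : ℂ) (φ : ℝ) (ω : ℂ) (n : ℕ) : ℂ :=
  lam ^ n * csinc (ω / 2 ^ n) * ∏ j ∈ Finset.Icc 1 n, Complex.cos (φ + ω / 2 ^ j)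

/-- `C(φ, ω)`. -/
def fourierC (lam : ℂ) (φ : ℝ) (ω : ℂ) : ℂ := ∑' n : ℕ, fourierTerm lam φ ω n

/-- The partial numerators `a` and partial denominators `b` of the continued fraction
`a₀ / (b₀ + a₁ / (b₁ + a₂ / (b₂ + ⋯)))` for `C(φ, ω) / (sin ω / ω)`. -/
def fourierCFPair (lam : ℂ) (φ : ℝ) (ω : ℂ) : ℕ → GenContFract.Pair ℂ
  | 0 => ⟨1, 1⟩
  | 1 => ⟨-(lam * Complex.cos (φ + ω / 2)), Complex.cos (ω / 2) + lam * Complex.cos (φ + ω / 2)⟩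
  | n + 2 => ⟨-(lam * Complex.cos (ω / 2 ^ (n + 1)) * Complex.cos (φ + ω / 2 ^ (n + 2))),
      Complex.cos (ω / 2 ^ (n + 2)) + lam * Complex.cos (φ + ω / 2 ^ (n + 2))⟩

/-- The continued fraction with the partial quotients `fourierCFPair`. -/
def fourierCF (lam : ℂ) (φ : ℝ) (ω : ℂ) : GenContFract ℂ :=
  ⟨0, Stream'.Seq.ofStream (fourierCFPair lam φ ω)⟩

end

/-! Write `S_n(x) = x_0 + ⋯ + x_{n-1}` for the digit walk and `W_φ = ∑ λ^n e^{iφ S_n}`.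
Orthogonality of the exponentials makes `V` the mean of `W_φ` over `φ` (`integral_walkSeries`,
`integral_returnV_mul`). Splitting off the first digit gives `W_φ((y ± 1)/2) = 1 + λ e^{±iφ}
W_φ(y)`. Integrated over the two halves of `(-1, 1)`, this becomes `integral_walkSeries_mul`: the
functional `h ↦ ∫ W_φ h` composed with `1 - λ (e^{-iφ} R_- + e^{iφ} R_+)/2` is `h ↦ ∫ h`. Parts
(ii), (iii) and (iv) come from this one identity.

For (ii), `‖z⁻¹ R_- + z R_+‖ ≤ 2` makes the operator invertible, so `∫ W_φ h` is the integral of the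
resolvent applied to `h`; then average over `z = e^{iφ}`.

For (iv), take `h = e^{iωx}`. The operators `R_±` halve the frequency, and iteration produces the
series `C`. Its consecutive terms have ratio `δ_{n+1}/γ_{n+1}` when the `γ_j` are nonzero, so it is
an Euler continued fraction whose convergents are its partial sums.

For (iii), take `h = x^k`. The moments of `W_φ` solve a triangular system with coefficients linear
in `u = λ cos φ` and `v = iλ sin φ`. Cramer's rule expresses `∫ W_φ P` by a bordered determinant, of
degree at most `N` in `(u, v)`, over `∏ (u - 2^n)`. Since `v² = u² - λ²`, Lagrange partial fractions
in `u` and the Poisson integral of `1/(1 - a cos φ)` give the average over `φ`.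

Part (i) uses renewal. Let `T_n` be the tail of the series for `V` from index `n`. The difference
`T_n^N - T_{n+1}^N` vanishes unless `S_n = 0`; then it is `λ^{nN} (V^N - (V - 1)^N)` at the
remainder, which is independent of the first `n` digits. Telescoping, with `∑ λ^n Prob(S_n = 0) =
1/√(1 - λ²)` taken at `λ^N`, yields `∫ (V - 1)^N = (1 - √(1 - λ^{2N})) ∫ V^N` for `N ≥ 1`. Expanding
`V^N` in powers of `V - 1` gives the recursion, and Cramer's rule the determinant. -/

noncomputable section

/-! ### The walk of partial digit sums -/

/-- The sum `x_0 + ⋯ + x_{n - 1}` of the first `n` signed binary digits. -/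
def digitWalk (x : ℝ) (n : ℕ) : ℤ := ∑ j ∈ Finset.range n, signedDigit x j

@[simp] theorem digitWalk_zero (x : ℝ) : digitWalk x 0 = 0 := rfl

theorem signedRem_add (x : ℝ) (m n : ℕ) :
    signedRem x (m + n) = signedRem (signedRem x m) n := by
  induction n with
  | zero => rfl
  | succ n ih => rw [← add_assoc, signedRem, signedRem, ih]

theorem signedDigit_add (x : ℝ) (m n : ℕ) :
    signedDigit x (m + n) = signedDigit (signedRem x m) n := by
  rw [signedDigit, signedDigit, signedRem_add]

theorem digitWalk_add (x : ℝ) (m n : ℕ) :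
    digitWalk x (m + n) = digitWalk x m + digitWalk (signedRem x m) n := by
  simp only [digitWalk, Finset.sum_range_add, signedDigit_add]

/-- The digit is `+1` only at positive points, so this branch must exclude `y = -1`, where `(y +
1)/2 = 0`; the left branch may keep `y = 1`. -/
theorem signedRem_right {y : ℝ} (hy : -1 < y) : signedRem ((y + 1) / 2) 1 = y := by
  have : 0 < (y + 1) / 2 := by linarith
  simp only [signedRem, this, if_true]
  ring

theorem signedRem_left {y : ℝ} (hy : y ≤ 1) : signedRem ((y + -1) / 2) 1 = y := by
  have : ¬ 0 < (y + -1) / 2 := by linarith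
  simp only [signedRem, this, if_false]
  ring

theorem digitWalk_right {y : ℝ} (hy : -1 < y) (n : ℕ) :
    digitWalk ((y + 1) / 2) (n + 1) = 1 + digitWalk y n := by
  have : 0 < (y + 1) / 2 := by linarith
  rw [add_comm n 1, digitWalk_add, signedRem_right hy]
  simp [digitWalk, signedDigit, signedRem, this]

theorem digitWalk_left {y : ℝ} (hy : y ≤ 1) (n : ℕ) :
    digitWalk ((y + -1) / 2) (n + 1) = -1 + digitWalk y n := by
  have : ¬ 0 < (y + -1) / 2 := by linarith
  rw [add_comm n 1, digitWalk_add, signedRem_left hy]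
  simp only [digitWalk, Finset.range_one, Finset.sum_singleton, signedDigit, signedRem, this,
    if_false]

@[fun_prop]
theorem measurable_signedRem (n : ℕ) : Measurable (fun x => signedRem x n) := by
  induction n with
  | zero => exact measurable_id
  | succ n ih =>
    simp only [signedRem]
    exact Measurable.ite (measurableSet_lt measurable_const ih) (by fun_prop) (by fun_prop)

@[fun_prop]
theorem measurable_signedDigit (n : ℕ) : Measurable (fun x => signedDigit x n) := by
  simp only [signedDigit]
  exact Measurable.ite (measurableSet_lt measurable_const (measurable_signedRem n))
    measurable_const measurable_const

@[fun_prop]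
theorem measurable_digitWalk (n : ℕ) : Measurable (fun x => digitWalk x n) := by
  unfold digitWalk
  exact Finset.measurable_fun_sum _ fun j _ => measurable_signedDigit j

/-! ### Lebesgue measure on `(-1, 1)` -/

instance : IsFiniteMeasure muI := by unfold muI; infer_instance

theorem integral_muI (f : ℝ → ℂ) : ∫ x, f x ∂muI = ∫ x in (-1 : ℝ)..1, f x := by
  rw [intervalIntegral.integral_of_le (by norm_num), muI, integral_Ioc_eq_integral_Ioo]

theorem integrable_muI_iff {f : ℝ → ℂ} :
    Integrable f muI ↔ IntervalIntegrable f volume (-1) 1 := by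
  rw [intervalIntegrable_iff_integrableOn_Ioo_of_le (by norm_num), muI, IntegrableOn]

theorem ae_muI_mem : ∀ᵐ x ∂muI, x ∈ Set.Ioo (-1 : ℝ) 1 :=
  ae_restrict_mem measurableSet_Ioo

theorem integrable_comp_affine {e : ℝ} (he : |e| ≤ 1) {f : ℝ → ℂ} (hf : Integrable f muI) :
    Integrable (fun x : ℝ => f ((x + e) / 2)) muI :=
  memLp_one_iff_integrable.1 (memLp_comp_affine he (memLp_one_iff_integrable.2 hf))

/-- The transfer identity: a point of `(-1, 1)` is a random digit followed by a random point. -/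
theorem integral_eq_halves {E : Type*} [NormedAddCommGroup E] [NormedSpace ℝ E] {f : ℝ → E}
    (hf : Integrable f muI) :
    ∫ x, f x ∂muI = (2⁻¹ : ℝ) •
      (∫ x, f ((x + -1) / 2) ∂muI + ∫ x, f ((x + 1) / 2) ∂muI) := by
  have hi : ∀ g : ℝ → E, ∫ x, g x ∂muI = ∫ x in (-1 : ℝ)..1, g x := fun g => by
    rw [intervalIntegral.integral_of_le (by norm_num), muI, integral_Ioc_eq_integral_Ioo]
  have hf' : IntervalIntegrable f volume (-1) 1 := by
    rwa [intervalIntegrable_iff_integrableOn_Ioo_of_le (by norm_num)]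
  have h0 : (0 : ℝ) ∈ Set.uIcc (-1) 1 := by rw [Set.uIcc_of_le (by norm_num)]; norm_num
  have h1 : ∀ e : ℝ, ∫ x in (-1 : ℝ)..1, f ((x + e) / 2) =
      (2 : ℝ) • ∫ x in ((-1 + e) / 2)..((1 + e) / 2), f x := fun e => by
    simp_rw [add_div]
    exact intervalIntegral.integral_comp_div_add f two_ne_zero (e / 2)
  rw [hi, hi, hi, h1, h1, ← smul_add, smul_smul]
  norm_num
  rw [intervalIntegral.integral_add_adjacent_intervals]
  · exact hf'.mono_set (Set.uIcc_subset_uIcc_left h0)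
  · exact hf'.mono_set (Set.uIcc_subset_uIcc_right h0)

/-! ### The generating series of the walk -/

/-- `∑ λ ^ n e ^ {i φ S_n(x)}`, where `S_n` is the digit walk. -/
def walkSeries (lam : ℂ) (φ : ℝ) (x : ℝ) : ℂ :=
  ∑' n : ℕ, lam ^ n * cexp (I * φ * digitWalk x n)

theorem norm_exp_I_mul_int (φ : ℝ) (k : ℤ) : ‖cexp (I * φ * k)‖ = 1 := by
  rw [show I * φ * k = ((φ * k : ℝ) : ℂ) * I by push_cast; ring, norm_exp_ofReal_mul_I]

theorem summable_walkSeries {lam : ℂ} (hlam : ‖lam‖ < 1) (φ x : ℝ) :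
    Summable (fun n : ℕ => lam ^ n * cexp (I * φ * digitWalk x n)) := by
  refine Summable.of_norm_bounded (summable_geometric_of_lt_one (norm_nonneg lam) hlam) fun n => ?_
  rw [norm_mul, norm_exp_I_mul_int, mul_one, norm_pow]

theorem norm_walkSeries_le {lam : ℂ} (hlam : ‖lam‖ < 1) (φ x : ℝ) :
    ‖walkSeries lam φ x‖ ≤ (1 - ‖lam‖)⁻¹ :=
  tsum_of_norm_bounded (hasSum_geometric_of_lt_one (norm_nonneg lam) hlam) fun n => by
    rw [norm_mul, norm_exp_I_mul_int, mul_one, norm_pow]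

theorem measurable_walkSeries (lam : ℂ) :
    Measurable (fun q : ℝ × ℝ => walkSeries lam q.1 q.2) := by
  unfold walkSeries
  refine Measurable.tsum fun n => ?_
  have : Measurable (fun q : ℝ × ℝ => ((digitWalk q.2 n : ℤ) : ℂ)) :=
    (measurable_of_countable (fun k : ℤ => (k : ℂ))).comp
      ((measurable_digitWalk n).comp measurable_snd)
  fun_prop

/-- Self-similarity: after the first digit `+1` the walk is that of `y` shifted by one, so every
term with `n ≥ 1` carries a factor `λ e^{iφ}`. -/
theorem walkSeries_right {lam : ℂ} (hlam : ‖lam‖ < 1) (φ : ℝ) {y : ℝ} (hy : -1 < y) :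
    walkSeries lam φ ((y + 1) / 2) = 1 + lam * cexp (I * φ) * walkSeries lam φ y := by
  rw [walkSeries, (summable_walkSeries hlam φ _).tsum_eq_zero_add, walkSeries, ← tsum_mul_left]
  simp only [digitWalk_right hy]
  congr 1
  · simp
  · refine tsum_congr fun n => ?_
    push_cast
    rw [mul_add, mul_one, Complex.exp_add]
    ring

theorem walkSeries_left {lam : ℂ} (hlam : ‖lam‖ < 1) (φ : ℝ) {y : ℝ} (hy : y ≤ 1) :
    walkSeries lam φ ((y + -1) / 2) = 1 + lam * cexp (-(I * φ)) * walkSeries lam φ y := by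
  rw [walkSeries, (summable_walkSeries hlam φ _).tsum_eq_zero_add, walkSeries, ← tsum_mul_left]
  simp only [digitWalk_left hy]
  congr 1
  · simp
  · refine tsum_congr fun n => ?_
    push_cast
    rw [mul_add, mul_neg_one, Complex.exp_add]
    ring

theorem measurable_walkSeries_right (lam : ℂ) (φ : ℝ) : Measurable (walkSeries lam φ) := by
  change Measurable ((fun q : ℝ × ℝ => walkSeries lam q.1 q.2) ∘ Prod.mk φ)
  exact (measurable_walkSeries lam).comp measurable_prodMk_left

theorem integrable_walkSeries_mul {lam : ℂ} (hlam : ‖lam‖ < 1) (φ : ℝ) {h : ℝ → ℂ}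
    (hh : Integrable h muI) : Integrable (fun x => walkSeries lam φ x * h x) muI :=
  hh.bdd_mul (measurable_walkSeries_right lam φ).aestronglyMeasurable
    (Eventually.of_forall fun x => norm_walkSeries_le hlam φ x)

/-- The functional `h ↦ ∫ W_φ h` inverts `1 - λ (e ^ {-iφ} R_- + e ^ {iφ} R_+) / 2`. -/
theorem integral_walkSeries_mul {lam : ℂ} (hlam : ‖lam‖ < 1) (φ : ℝ) {h : ℝ → ℂ}
    (hh : Integrable h muI) :
    ∫ x, walkSeries lam φ x * h x ∂muI = ∫ x, h x ∂muI + lam / 2 *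
      (cexp (-(I * φ)) * ∫ x, walkSeries lam φ x * h ((x + -1) / 2) ∂muI +
        cexp (I * φ) * ∫ x, walkSeries lam φ x * h ((x + 1) / 2) ∂muI) := by
  have hm := integrable_comp_affine (e := -1) (by simp) hh
  have hp := integrable_comp_affine (e := 1) (by simp) hh
  -- Conditioning on the first digit lets self-similarity act on each half; the constants `1`
  -- reassemble to `∫ h`.
  rw [integral_eq_halves (integrable_walkSeries_mul hlam φ hh), integral_eq_halves hh]
  have e1 : ∫ x, walkSeries lam φ ((x + -1) / 2) * h ((x + -1) / 2) ∂muI =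
      ∫ x, (h ((x + -1) / 2) +
        lam * cexp (-(I * φ)) * (walkSeries lam φ x * h ((x + -1) / 2))) ∂muI := by
    refine integral_congr_ae (ae_muI_mem.mono fun x hx => ?_)
    simp only [walkSeries_left hlam φ hx.2.le]
    ring
  have e2 : ∫ x, walkSeries lam φ ((x + 1) / 2) * h ((x + 1) / 2) ∂muI =
      ∫ x, (h ((x + 1) / 2) +
        lam * cexp (I * φ) * (walkSeries lam φ x * h ((x + 1) / 2))) ∂muI := by
    refine integral_congr_ae (ae_muI_mem.mono fun x hx => ?_)
    simp only [walkSeries_right hlam φ hx.1]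
    ring
  rw [e1, e2, integral_add hm ((integrable_walkSeries_mul hlam φ hm).const_mul _),
    integral_add hp ((integrable_walkSeries_mul hlam φ hp).const_mul _), integral_const_mul,
    integral_const_mul]
  simp only [real_smul]
  push_cast
  ring

/-! ### `V` as the mean of the generating series -/

theorem summable_returnV {lam : ℂ} (hlam : ‖lam‖ < 1) (x : ℝ) :
    Summable (fun n : ℕ => lam ^ n * (if digitWalk x n = 0 then (1 : ℂ) else 0)) := by
  refine Summable.of_norm_bounded (summable_geometric_of_lt_one (norm_nonneg lam) hlam)
    fun n => ?_
  split_ifs <;> simp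

theorem returnV_eq_tsum {lam : ℂ} (hlam : ‖lam‖ < 1) (x : ℝ) :
    returnV lam x = ∑' n : ℕ, lam ^ n * (if digitWalk x n = 0 then 1 else 0) := by
  rw [(summable_returnV hlam x).tsum_eq_zero_add, returnV, digitWalk_zero, if_pos rfl, pow_zero, mul_one]
  rfl

theorem hasSum_returnV {lam : ℂ} (hlam : ‖lam‖ < 1) (x : ℝ) :
    HasSum (fun n : ℕ => lam ^ n * (if digitWalk x n = 0 then 1 else 0)) (returnV lam x) := by
  rw [returnV_eq_tsum hlam]
  exact (summable_returnV hlam x).hasSum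

theorem norm_returnV_le {lam : ℂ} (hlam : ‖lam‖ < 1) (x : ℝ) :
    ‖returnV lam x‖ ≤ (1 - ‖lam‖)⁻¹ := by
  rw [returnV_eq_tsum hlam]
  exact tsum_of_norm_bounded (hasSum_geometric_of_lt_one (norm_nonneg lam) hlam) fun n => by
    split_ifs <;> simp

@[fun_prop]
theorem measurable_returnV (lam : ℂ) : Measurable (returnV lam) := by
  unfold returnV
  refine measurable_const.add (Measurable.tsum fun n => measurable_const.mul ?_)
  exact Measurable.ite (measurable_digitWalk (n + 1) (measurableSet_singleton 0))
    measurable_const measurable_const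

theorem integrable_returnV_mul {lam : ℂ} (hlam : ‖lam‖ < 1) {h : ℝ → ℂ}
    (hh : Integrable h muI) : Integrable (fun x => returnV lam x * h x) muI :=
  hh.bdd_mul (measurable_returnV lam).aestronglyMeasurable
    (Eventually.of_forall fun x => norm_returnV_le hlam x)

theorem integral_exp_int_mul (a : ℝ) (k : ℤ) :
    ∫ φ in a..(a + 2 * Real.pi), cexp (I * φ * k) = if k = 0 then 2 * (Real.pi : ℂ) else 0 := by
  split_ifs with hk
  · simp [hk]
  · have hc : I * (k : ℂ) ≠ 0 := mul_ne_zero I_ne_zero (by exact_mod_cast hk)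
    have : ∀ φ : ℝ, I * φ * k = I * k * φ := fun φ => by ring
    simp_rw [this]
    rw [integral_exp_mul_complex hc]
    have : I * k * ((a + 2 * Real.pi : ℝ) : ℂ) = I * k * a + k * (2 * Real.pi * I) := by
      push_cast; ring
    rw [this, Complex.exp_add, exp_int_mul_two_pi_mul_I]
    simp

/-- Integration over a full period keeps exactly the terms with `S_n = 0`. The base point `a` is
free because both `[0, 2π]` (contour integrals) and `[-π, π]` (parity arguments) are needed. -/
theorem integral_walkSeries {lam : ℂ} (hlam : ‖lam‖ < 1) (a x : ℝ) :
    ∫ φ in a..(a + 2 * Real.pi), walkSeries lam φ x = 2 * Real.pi * returnV lam x := by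
  have h := intervalIntegral.hasSum_integral_of_dominated_convergence (μ := volume)
    (a := a) (b := a + 2 * Real.pi)
    (F := fun (n : ℕ) (φ : ℝ) => lam ^ n * cexp (I * φ * digitWalk x n))
    (f := fun φ => walkSeries lam φ x) (fun n _ => ‖lam‖ ^ n)
    (fun n => (by fun_prop : Continuous _).aestronglyMeasurable)
    (fun n => Eventually.of_forall fun φ _ => by
      rw [norm_mul, norm_exp_I_mul_int, mul_one, norm_pow])
    (Eventually.of_forall fun φ _ => summable_geometric_of_lt_one (norm_nonneg lam) hlam)
    (by simp)
    (Eventually.of_forall fun φ _ => (summable_walkSeries hlam φ x).hasSum)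
  refine h.unique ?_
  refine ((hasSum_returnV hlam x).mul_left (2 * (Real.pi : ℂ))).congr_fun fun n => ?_
  rw [intervalIntegral.integral_const_mul, integral_exp_int_mul]
  split_ifs <;> ring

/-- Fubini, justified by the uniform bound `(1 - |λ|)⁻¹` on `W_φ`. -/
theorem integral_returnV_mul {lam : ℂ} (hlam : ‖lam‖ < 1) (a : ℝ) {h : ℝ → ℂ}
    (hh : Integrable h muI) :
    ∫ x, returnV lam x * h x ∂muI = (2 * Real.pi : ℂ)⁻¹ *
      ∫ φ in a..(a + 2 * Real.pi), ∫ x, walkSeries lam φ x * h x ∂muI := by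
  have : IsFiniteMeasure (volume.restrict (Set.uIoc a (a + 2 * Real.pi))) :=
    ⟨by simp [Set.uIoc]⟩
  have hi : Integrable (Function.uncurry fun (φ : ℝ) (x : ℝ) => walkSeries lam φ x * h x)
      ((volume.restrict (Set.uIoc a (a + 2 * Real.pi))).prod muI) := by
    have h2 : Integrable (fun q : ℝ × ℝ => h q.2)
        ((volume.restrict (Set.uIoc a (a + 2 * Real.pi))).prod muI) := hh.comp_snd _
    exact h2.bdd_mul (measurable_walkSeries lam).aestronglyMeasurable
      (Eventually.of_forall fun q => norm_walkSeries_le hlam q.1 q.2)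
  rw [intervalIntegral_integral_swap hi, ← integral_const_mul]
  refine integral_congr_ae (Eventually.of_forall fun x => ?_)
  simp only [intervalIntegral.integral_mul_const, integral_walkSeries hlam]
  have : (Real.pi : ℂ) ≠ 0 := by exact_mod_cast Real.pi_ne_zero
  field_simp

/-! ### Principal square roots and the Poisson kernel -/

theorem sqrt_mul_self (a : ℂ) : Complex.sqrt a * Complex.sqrt a = a := by
  rw [← sq, Complex.sqrt]
  exact_mod_cast cpow_nat_inv_pow a two_ne_zero

/-- This positivity is all that is needed about the principal branch: it makes the root nonzero and
`1 + √(1 - a)` of modulus greater than `1`. -/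
theorem sqrt_one_sub_re_pos {a : ℂ} (ha : ‖a‖ < 1) : 0 < (Complex.sqrt (1 - a)).re := by
  rw [Complex.sqrt, cpow_inv_two_re]
  have h1 : 0 < (1 - a).re := by
    rw [sub_re, one_re]
    linarith [re_le_norm a]
  have := norm_nonneg (1 - a)
  positivity

theorem sqrt_one_sub_ne_zero {a : ℂ} (ha : ‖a‖ < 1) : Complex.sqrt (1 - a) ≠ 0 := fun h => by
  simpa [h] using sqrt_one_sub_re_pos ha

theorem one_lt_norm_one_add_sqrt {a : ℂ} (ha : ‖a‖ < 1) : 1 < ‖1 + Complex.sqrt (1 - a)‖ := by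
  have h1 := sqrt_one_sub_re_pos ha
  have h2 := re_le_norm (1 + Complex.sqrt (1 - a))
  rw [add_re, one_re] at h2
  linarith

theorem one_add_sqrt_ne_zero {a : ℂ} (ha : ‖a‖ < 1) : 1 + Complex.sqrt (1 - a) ≠ 0 :=
  norm_pos_iff.1 (one_pos.trans (one_lt_norm_one_add_sqrt ha))

/-- In the geometric expansion only the constant term survives integration over a period. -/
theorem integral_inv_one_sub_mul_exp {w : ℂ} (hw : ‖w‖ < 1) (a : ℝ) {k : ℤ} (hk : k ≠ 0) :
    ∫ φ in a..(a + 2 * Real.pi), (1 - w * cexp (I * φ * k))⁻¹ = 2 * Real.pi := by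
  have h := intervalIntegral.hasSum_integral_of_dominated_convergence (μ := volume)
    (a := a) (b := a + 2 * Real.pi)
    (F := fun (n : ℕ) (φ : ℝ) => w ^ n * cexp (I * φ * (k * n : ℤ)))
    (f := fun φ => (1 - w * cexp (I * φ * k))⁻¹) (fun n _ => ‖w‖ ^ n)
    (fun n => (by fun_prop : Continuous _).aestronglyMeasurable)
    (fun n => Eventually.of_forall fun φ _ => by
      rw [norm_mul, norm_exp_I_mul_int, mul_one, norm_pow])
    (Eventually.of_forall fun φ _ => summable_geometric_of_lt_one (norm_nonneg w) hw)
    (by simp)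
    (Eventually.of_forall fun φ _ => by
      have h1 : ‖w * cexp (I * φ * k)‖ < 1 := by
        rwa [norm_mul, norm_exp_I_mul_int, mul_one]
      refine (hasSum_geometric_of_norm_lt_one h1).congr_fun fun n => ?_
      rw [mul_pow, ← Complex.exp_nat_mul]
      push_cast
      ring_nf)
  rw [h.unique (hasSum_single 0 fun n hn => ?_)]
  · simp
  · rw [intervalIntegral.integral_const_mul, integral_exp_int_mul, if_neg, mul_zero]
    exact mul_ne_zero hk (by exact_mod_cast hn)

theorem norm_mul_cos_le (lam : ℂ) (φ : ℝ) : ‖lam * Complex.cos φ‖ ≤ ‖lam‖ := by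
  rw [norm_mul, ← ofReal_cos, norm_real]
  exact mul_le_of_le_one_right (norm_nonneg _) (Real.abs_cos_le_one φ)

theorem one_sub_mul_cos_ne_zero {lam : ℂ} (hlam : ‖lam‖ < 1) (φ : ℝ) :
    1 - lam * Complex.cos φ ≠ 0 := fun h => by
  have h1 := norm_mul_cos_le lam φ
  rw [← sub_eq_zero.1 h, norm_one] at h1
  linarith

/-- The Poisson kernel: `1 - λ cos φ` is a constant times `(1 - w e^{iφ})(1 - w e^{-iφ})`, and its
inverse splits into two geometric series. -/
theorem integral_inv_one_sub_mul_cos {lam : ℂ} (hlam : ‖lam‖ < 1) (a : ℝ) :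
    ∫ φ in a..(a + 2 * Real.pi), (1 - lam * Complex.cos φ)⁻¹ =
      2 * Real.pi / Complex.sqrt (1 - lam ^ 2) := by
  have hl2 : ‖lam ^ 2‖ < 1 := by
    rw [norm_pow]; exact pow_lt_one₀ (norm_nonneg _) hlam two_ne_zero
  set s := Complex.sqrt (1 - lam ^ 2) with hs
  have hs0 : s ≠ 0 := sqrt_one_sub_ne_zero hl2
  have hs1 : 1 + s ≠ 0 := one_add_sqrt_ne_zero hl2
  have hss : s * s = 1 - lam ^ 2 := sqrt_mul_self _
  -- This `w` solves `λ (1 + w²) = 2w`, and `|w| < 1` because `|1 + s| > 1 > |λ|`.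
  set w := lam / (1 + s) with hw
  have hw1 : ‖w‖ < 1 := by
    rw [hw, norm_div, div_lt_one (norm_pos_iff.2 hs1)]
    exact hlam.trans (one_lt_norm_one_add_sqrt hl2)
  have hne : ∀ (φ : ℝ) (k : ℤ), 1 - w * cexp (I * φ * k) ≠ 0 := fun φ k h => by
    have : ‖w * cexp (I * φ * k)‖ < 1 := by rwa [norm_mul, norm_exp_I_mul_int, mul_one]
    rw [← sub_eq_zero.1 h, norm_one] at this
    exact lt_irrefl _ this
  have hc : ∀ k : ℤ, Continuous fun φ : ℝ => (1 - w * cexp (I * φ * k))⁻¹ := fun k =>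
    Continuous.inv₀ (by fun_prop) fun φ => hne φ k
  have key : ∀ φ : ℝ, (1 - lam * Complex.cos φ)⁻¹ = s⁻¹ *
      ((1 - w * cexp (I * φ * (1 : ℤ)))⁻¹ + (1 - w * cexp (I * φ * (-1 : ℤ)))⁻¹ - 1) := by
    intro φ
    have h1 := hne φ 1
    have h2 := hne φ (-1)
    have h3 := one_sub_mul_cos_ne_zero hlam φ
    have hE : cexp (I * φ * (1 : ℤ)) * cexp (I * φ * (-1 : ℤ)) = 1 := by
      rw [← Complex.exp_add]
      simp
    have hcos : Complex.cos φ = (cexp (I * φ * (1 : ℤ)) + cexp (I * φ * (-1 : ℤ))) / 2 := by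
      rw [Complex.cos]
      congr 2
      · congr 1; push_cast; ring
      · congr 1; push_cast; ring
    rw [hcos] at h3 ⊢
    generalize cexp (I * φ * (1 : ℤ)) = e at *
    generalize cexp (I * φ * (-1 : ℤ)) = f at *
    have hlw : lam = w * (1 + s) := by rw [hw]; field_simp
    have hww : w ^ 2 * (1 + s) = 1 - s := by
      rw [hw, div_pow]
      field_simp
      linear_combination hss
    have h4 : (1 + s) * ((1 - w * e) * (1 - w * f)) = 2 * (1 - lam * ((e + f) / 2)) := by
      rw [hlw]
      linear_combination (1 + s) * w ^ 2 * hE + hww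
    have h5 : (1 + s) * ((1 - w * e) + (1 - w * f) - (1 - w * e) * (1 - w * f)) = 2 * s := by
      linear_combination (-(1 + s) * w ^ 2) * hE - hww
    generalize 1 - w * e = A at *
    generalize 1 - w * f = B at *
    generalize 1 - lam * ((e + f) / 2) = C at *
    field_simp
    refine mul_left_cancel₀ hs1 ?_
    linear_combination s * h4 - C * h5
  simp_rw [key]
  rw [intervalIntegral.integral_const_mul, intervalIntegral.integral_sub
      (((hc 1).intervalIntegrable _ _).add ((hc (-1)).intervalIntegrable _ _)) intervalIntegrable_const,
    intervalIntegral.integral_add ((hc 1).intervalIntegrable _ _)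
      ((hc (-1)).intervalIntegrable _ _), integral_inv_one_sub_mul_exp hw1 a one_ne_zero,
    integral_inv_one_sub_mul_exp hw1 a (by norm_num : (-1 : ℤ) ≠ 0)]
  simp
  field_simp

/-! ### Determinants with a known solution -/

/-- Cramer's rule for a system whose right-hand side is supported in the last row. -/
theorem det_mul_of_mulVec_eq_single {R : Type*} [CommRing R] {n : ℕ}
    {A : Matrix (Fin (n + 1)) (Fin (n + 1)) R} {y : Fin (n + 1) → R} {c : R}
    (h : A.mulVec y = Pi.single (Fin.last n) c) (i : Fin (n + 1)) :
    A.det * y i =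
      (-1) ^ (n + (i : ℕ)) * (A.submatrix Fin.castSucc i.succAbove).det * c := by
  have h1 : A.adjugate.mulVec (A.mulVec y) = A.det • y := by
    rw [Matrix.mulVec_mulVec, Matrix.adjugate_mul, Matrix.smul_mulVec, Matrix.one_mulVec]
  rw [h] at h1
  have h2 := congrFun h1 i
  rw [Pi.smul_apply, smul_eq_mul] at h2
  rw [← h2, Matrix.mulVec_single]
  have := Matrix.adjugate_fin_succ_eq_det_submatrix A i (Fin.last n)
  rw [Fin.succAbove_last, Fin.val_last] at this
  simp [this]

/-- Expansion along a last row with a single nonzero entry. -/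
theorem det_eq_of_last_row {R : Type*} [CommRing R] {n : ℕ}
    {A : Matrix (Fin (n + 1)) (Fin (n + 1)) R} (i : Fin (n + 1))
    (h : ∀ j, j ≠ i → A (Fin.last n) j = 0) :
    A.det = (-1) ^ (n + (i : ℕ)) * A (Fin.last n) i *
      (A.submatrix Fin.castSucc i.succAbove).det := by
  rw [Matrix.det_succ_row A (Fin.last n), Finset.sum_eq_single i]
  · rw [Fin.succAbove_last, Fin.val_last]
  · intro j _ hj
    rw [h j hj]; simp
  · simp

/-! ### Moments of `V` -/

theorem integrable_of_bounded {f : ℝ → ℂ} (hf : Measurable f) {C : ℝ} (hC : ∀ x, ‖f x‖ ≤ C) :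
    Integrable f muI :=
  Integrable.of_bound hf.aestronglyMeasurable C (Eventually.of_forall hC)

/-- The probability that the simple random walk is at `c` after `n` steps. -/
def walkProb : ℕ → ℤ → ℂ
  | 0, c => if c = 0 then 1 else 0
  | n + 1, c => (walkProb n (c + 1) + walkProb n (c - 1)) / 2

/-- The first `n` digits are independent of the remainder. -/
theorem integral_walk_mul_comp_rem {G : ℝ → ℂ} (hG : Measurable G) {C : ℝ}
    (hC : ∀ x, ‖G x‖ ≤ C) (n : ℕ) (c : ℤ) :
    ∫ x, (if digitWalk x n = c then 1 else 0) * G (signedRem x n) ∂muI =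
      walkProb n c * ∫ x, G x ∂muI := by
  induction n generalizing c with
  | zero =>
    simp only [digitWalk_zero, signedRem, walkProb, eq_comm (a := (0 : ℤ))]
    rw [integral_const_mul]
  | succ n ih =>
    have hi : Integrable (fun x => (if digitWalk x (n + 1) = c then 1 else 0) *
        G (signedRem x (n + 1))) muI := by
      refine integrable_of_bounded (C := C) ?_ fun x => ?_
      · exact (Measurable.ite (measurable_digitWalk (n + 1) (measurableSet_singleton c))
          measurable_const measurable_const).mul (hG.comp (measurable_signedRem _))
      · split_ifs
        · simpa using hC _
        · simpa using (norm_nonneg _).trans (hC x)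
    rw [integral_eq_halves hi]
    -- On the left half the first digit is `-1`, so the other `n` digits must sum to `c + 1`; on the
    -- right half, to `c - 1`. This is the recursion of `walkProb`.
    have e1 : ∫ x, (if digitWalk ((x + -1) / 2) (n + 1) = c then 1 else 0) *
        G (signedRem ((x + -1) / 2) (n + 1)) ∂muI =
        ∫ x, (if digitWalk x n = c + 1 then 1 else 0) * G (signedRem x n) ∂muI := by
      refine integral_congr_ae (ae_muI_mem.mono fun x hx => ?_)
      have : -1 + digitWalk x n = c ↔ digitWalk x n = c + 1 := by omega
      simp only [digitWalk_left hx.2.le, add_comm n 1 ▸ signedRem_add ((x + -1) / 2) 1 n,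
        signedRem_left hx.2.le, this]
    have e2 : ∫ x, (if digitWalk ((x + 1) / 2) (n + 1) = c then 1 else 0) *
        G (signedRem ((x + 1) / 2) (n + 1)) ∂muI =
        ∫ x, (if digitWalk x n = c - 1 then 1 else 0) * G (signedRem x n) ∂muI := by
      refine integral_congr_ae (ae_muI_mem.mono fun x hx => ?_)
      have : 1 + digitWalk x n = c ↔ digitWalk x n = c - 1 := by omega
      simp only [digitWalk_right hx.1, add_comm n 1 ▸ signedRem_add ((x + 1) / 2) 1 n,
        signedRem_right hx.1, this]
    rw [e1, e2, ih, ih, walkProb, real_smul]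
    push_cast
    ring

theorem integral_muI_one : ∫ _x, (1 : ℂ) ∂muI = 2 := by
  rw [integral_muI]
  simp
  norm_num

theorem integral_walkSeries_one {lam : ℂ} (hlam : ‖lam‖ < 1) (φ : ℝ) :
    ∫ x, walkSeries lam φ x * 1 ∂muI = 2 * (1 - lam * Complex.cos φ)⁻¹ := by
  have h := integral_walkSeries_mul hlam φ (h := fun _ => 1) (integrable_const 1)
  simp only [integral_muI_one] at h
  have h1 := one_sub_mul_cos_ne_zero hlam φ
  have hcos : Complex.cos φ = (cexp (I * φ) + cexp (-(I * φ))) / 2 := by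
    rw [Complex.cos, mul_comm I, neg_mul]
  rw [← div_eq_mul_inv, eq_div_iff h1, hcos]
  linear_combination h

theorem integral_returnV {lam : ℂ} (hlam : ‖lam‖ < 1) :
    ∫ x, returnV lam x ∂muI = 2 / Complex.sqrt (1 - lam ^ 2) := by
  have h := integral_returnV_mul hlam 0 (h := fun _ => 1) (integrable_const 1)
  simp only [integral_walkSeries_one hlam] at h
  rw [intervalIntegral.integral_const_mul, integral_inv_one_sub_mul_cos hlam] at h
  simp only [mul_one] at h
  rw [h]
  have : (Real.pi : ℂ) ≠ 0 := by exact_mod_cast Real.pi_ne_zero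
  field_simp

/-- Termwise integration of the series for `V`, whose integral is already known; the interval has
length `2`. This is the generating function of the return probabilities. -/
theorem hasSum_walkProb_zero {lam : ℂ} (hlam : ‖lam‖ < 1) :
    HasSum (fun n => lam ^ n * walkProb n 0) (1 / Complex.sqrt (1 - lam ^ 2)) := by
  have h := hasSum_integral_of_dominated_convergence (μ := muI)
    (F := fun (n : ℕ) (x : ℝ) => lam ^ n * (if digitWalk x n = 0 then 1 else 0))
    (f := returnV lam) (fun n _ => ‖lam‖ ^ n)
    (fun n => (measurable_const.mul (Measurable.ite
      (measurable_digitWalk n (measurableSet_singleton 0)) measurable_const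
        measurable_const)).aestronglyMeasurable)
    (fun n => Eventually.of_forall fun x => by split_ifs <;> simp)
    (Eventually.of_forall fun x => summable_geometric_of_lt_one (norm_nonneg lam) hlam)
    (integrable_const _)
    (Eventually.of_forall fun x => hasSum_returnV hlam x)
  rw [integral_returnV hlam] at h
  rw [show 1 / Complex.sqrt (1 - lam ^ 2) = 2 / Complex.sqrt (1 - lam ^ 2) / 2 by ring]
  refine (h.div_const 2).congr_fun fun n => ?_
  have := integral_walk_mul_comp_rem (G := fun _ => 1) measurable_const (C := 1) (by simp) n 0
  simp only [integral_muI_one, mul_one] at this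
  rw [integral_const_mul, this]
  ring

/-- The tail `∑_{m ≥ n} λ ^ m L_m` of the series for `V`. -/
def returnTail (lam : ℂ) (n : ℕ) (x : ℝ) : ℂ :=
  returnV lam x - ∑ m ∈ Finset.range n, lam ^ m * (if digitWalk x m = 0 then 1 else 0)

theorem hasSum_returnTail {lam : ℂ} (hlam : ‖lam‖ < 1) (n : ℕ) (x : ℝ) :
    HasSum (fun m => lam ^ (m + n) * (if digitWalk x (m + n) = 0 then 1 else 0))
      (returnTail lam n x) := by
  rw [hasSum_nat_add_iff (f := fun m => lam ^ m * (if digitWalk x m = 0 then (1 : ℂ) else 0)),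
    returnTail, sub_add_cancel]
  exact hasSum_returnV hlam x

theorem norm_returnTail_le {lam : ℂ} (hlam : ‖lam‖ < 1) (n : ℕ) (x : ℝ) :
    ‖returnTail lam n x‖ ≤ ‖lam‖ ^ n * (1 - ‖lam‖)⁻¹ := by
  rw [← (hasSum_returnTail hlam n x).tsum_eq]
  refine tsum_of_norm_bounded
    ((hasSum_geometric_of_lt_one (norm_nonneg lam) hlam).mul_left (‖lam‖ ^ n)) fun m => ?_
  rw [← pow_add, add_comm n m]
  split_ifs
  · simp
  · simp

theorem measurable_returnTail (lam : ℂ) (n : ℕ) : Measurable (returnTail lam n) := by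
  unfold returnTail
  refine (measurable_returnV lam).sub (Finset.measurable_fun_sum _ fun m _ => ?_)
  exact measurable_const.mul (Measurable.ite
      (measurable_digitWalk m (measurableSet_singleton 0)) measurable_const measurable_const)

theorem returnTail_succ (lam : ℂ) (n : ℕ) (x : ℝ) :
    returnTail lam (n + 1) x =
      returnTail lam n x - lam ^ n * (if digitWalk x n = 0 then 1 else 0) := by
  rw [returnTail, returnTail, Finset.sum_range_succ]
  ring

/-- After a return to `0` at time `n` the walk restarts from the remainder. -/
theorem returnTail_of_walk_eq_zero {lam : ℂ} (hlam : ‖lam‖ < 1) {n : ℕ} {x : ℝ}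
    (h : digitWalk x n = 0) : returnTail lam n x = lam ^ n * returnV lam (signedRem x n) := by
  refine (hasSum_returnTail hlam n x).unique ?_
  refine ((hasSum_returnV hlam (signedRem x n)).mul_left (lam ^ n)).congr_fun fun m => ?_
  rw [add_comm m n, digitWalk_add, h, zero_add, pow_add, mul_assoc]

/-- Consecutive tails differ only at a return, and there both are `λ^n` times a function of the
remainder, so independence from the first `n` digits can be used. -/
theorem returnTail_pow_sub {lam : ℂ} (hlam : ‖lam‖ < 1) (N n : ℕ) (x : ℝ) :
    returnTail lam n x ^ N - returnTail lam (n + 1) x ^ N =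
      (lam ^ N) ^ n * ((if digitWalk x n = 0 then 1 else 0) *
        (returnV lam (signedRem x n) ^ N - (returnV lam (signedRem x n) - 1) ^ N)) := by
  rw [returnTail_succ]
  split_ifs with h
  · rw [returnTail_of_walk_eq_zero hlam h, ← mul_sub, mul_pow, mul_pow, ← pow_mul, ← pow_mul,
      mul_comm n N]
    ring
  · simp

theorem norm_returnV_sub_one_le {lam : ℂ} (hlam : ‖lam‖ < 1) (x : ℝ) :
    ‖returnV lam x - 1‖ ≤ (1 - ‖lam‖)⁻¹ + 1 :=
  (norm_sub_le _ _).trans (by rw [norm_one]; linarith [norm_returnV_le hlam x])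

theorem integrable_returnV_pow {lam : ℂ} (hlam : ‖lam‖ < 1) (N : ℕ) :
    Integrable (fun x => returnV lam x ^ N) muI :=
  integrable_of_bounded (C := ((1 - ‖lam‖)⁻¹) ^ N) (by fun_prop) fun x => by
    rw [norm_pow]; exact pow_le_pow_left₀ (norm_nonneg _) (norm_returnV_le hlam x) N

theorem integrable_returnV_sub_one_pow {lam : ℂ} (hlam : ‖lam‖ < 1) (N : ℕ) :
    Integrable (fun x => (returnV lam x - 1) ^ N) muI :=
  integrable_of_bounded (C := ((1 - ‖lam‖)⁻¹ + 1) ^ N) (by fun_prop) fun x => by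
    rw [norm_pow]; exact pow_le_pow_left₀ (norm_nonneg _) (norm_returnV_sub_one_le hlam x) N

theorem norm_pow_lt_one {lam : ℂ} (hlam : ‖lam‖ < 1) {N : ℕ} (hN : N ≠ 0) : ‖lam ^ N‖ < 1 := by
  rw [norm_pow]; exact pow_lt_one₀ (norm_nonneg _) hlam hN

/-- Telescoping over the tails gives `∫ V^N = K ∑ (λ^N)^n Prob(S_n = 0) = K / √(1 - λ^{2N})`, with
`K` as below; solve for the integral of `(V - 1)^N`. -/
theorem integral_returnV_sub_one_pow {lam : ℂ} (hlam : ‖lam‖ < 1) {N : ℕ} (hN : N ≠ 0) :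
    ∫ x, (returnV lam x - 1) ^ N ∂muI =
      (1 - Complex.sqrt (1 - lam ^ (2 * N))) * ∫ x, returnV lam x ^ N ∂muI := by
  set K := ∫ x, (returnV lam x ^ N - (returnV lam x - 1) ^ N) ∂muI with hK
  have ht : ∀ n, Integrable (fun x => returnTail lam n x ^ N) muI := fun n =>
    integrable_of_bounded (C := (‖lam‖ ^ n * (1 - ‖lam‖)⁻¹) ^ N)
      ((measurable_returnTail lam n).pow_const N) fun x => by
        rw [norm_pow]; exact pow_le_pow_left₀ (norm_nonneg _) (norm_returnTail_le hlam n x) N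
  have hstep : ∀ n, ∫ x, returnTail lam n x ^ N ∂muI - ∫ x, returnTail lam (n + 1) x ^ N ∂muI =
      (lam ^ N) ^ n * walkProb n 0 * K := fun n => by
    rw [← integral_sub (ht n) (ht (n + 1))]
    simp only [returnTail_pow_sub hlam]
    rw [integral_const_mul, integral_walk_mul_comp_rem
      (G := fun y => returnV lam y ^ N - (returnV lam y - 1) ^ N)
      (C := ((1 - ‖lam‖)⁻¹) ^ N + ((1 - ‖lam‖)⁻¹ + 1) ^ N) (by fun_prop) fun x => ?_, mul_assoc]
    refine (norm_sub_le _ _).trans (add_le_add ?_ ?_)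
    · rw [norm_pow]; exact pow_le_pow_left₀ (norm_nonneg _) (norm_returnV_le hlam x) N
    · rw [norm_pow]; exact pow_le_pow_left₀ (norm_nonneg _) (norm_returnV_sub_one_le hlam x) N
  have hsum : ∀ M, ∑ n ∈ Finset.range M, (lam ^ N) ^ n * walkProb n 0 * K =
      ∫ x, returnV lam x ^ N ∂muI - ∫ x, returnTail lam M x ^ N ∂muI := fun M => by
    simp_rw [← hstep]
    rw [Finset.sum_range_sub']
    simp [returnTail]
  -- The tails are `O(|λ|^M)`; the exponent `N` must be nonzero for their powers to vanish in the
  -- limit.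
  have hlim : Tendsto (fun M => ∫ x, returnTail lam M x ^ N ∂muI) atTop (𝓝 0) := by
    have hb : ∀ M, ‖∫ x, returnTail lam M x ^ N ∂muI‖ ≤
        (‖lam‖ ^ M * (1 - ‖lam‖)⁻¹) ^ N * muI.real Set.univ := fun M =>
      norm_integral_le_of_norm_le_const (Eventually.of_forall fun x => by
        rw [norm_pow]; exact pow_le_pow_left₀ (norm_nonneg _) (norm_returnTail_le hlam M x) N)
    refine squeeze_zero_norm hb ?_
    have := (((tendsto_pow_atTop_nhds_zero_of_lt_one (norm_nonneg lam) hlam).mul_const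
      ((1 - ‖lam‖)⁻¹)).pow N).mul_const (muI.real Set.univ)
    simpa [hN] using this
  have h1 := ((hasSum_walkProb_zero (norm_pow_lt_one hlam hN)).mul_right K).tendsto_sum_nat
  simp_rw [hsum] at h1
  have h2 := tendsto_nhds_unique h1 (tendsto_const_nhds.sub hlim)
  rw [hK, integral_sub (integrable_returnV_pow hlam N) (integrable_returnV_sub_one_pow hlam N),
    sub_zero, ← pow_mul, mul_comm N 2] at h2
  have hs := sqrt_one_sub_ne_zero (norm_pow_lt_one hlam (N := 2 * N) (by omega))
  rw [one_div, inv_mul_eq_iff_eq_mul₀ hs] at h2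
  linear_combination -h2

/-- The recursion for the moments of `V`. -/
theorem integral_returnV_pow {lam : ℂ} (hlam : ‖lam‖ < 1) (N : ℕ) :
    ∫ x, returnV lam x ^ N ∂muI = 2 + ∑ n ∈ Finset.Icc 1 N, (N.choose n : ℂ) *
      (1 - Complex.sqrt (1 - lam ^ (2 * n))) * ∫ x, returnV lam x ^ n ∂muI := by
  have h : ∀ x, returnV lam x ^ N =
      ∑ n ∈ Finset.range (N + 1), (N.choose n : ℂ) * (returnV lam x - 1) ^ n := fun x => by
    conv_lhs => rw [← sub_add_cancel (returnV lam x) 1, add_pow]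
    exact Finset.sum_congr rfl fun n _ => by ring
  simp_rw [h]
  rw [integral_finsetSum _ fun n _ => (integrable_returnV_sub_one_pow hlam n).const_mul _]
  rw [Finset.range_eq_Ico, Finset.sum_eq_sum_Ico_succ_bot (by omega)]
  congr 1
  · simp only [Nat.choose_zero_right, Nat.cast_one, pow_zero, mul_one, integral_muI_one]
  · rw [zero_add]
    refine Finset.sum_congr rfl fun n hn => ?_
    rw [Finset.mem_Icc] at hn
    rw [integral_const_mul, integral_returnV_sub_one_pow hlam (by omega), mul_assoc]

theorem integral_returnV_pow_eq_div {lam : ℂ} (hlam : ‖lam‖ < 1) {N : ℕ} (hN : 1 ≤ N) :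
    ∫ x, returnV lam x ^ N ∂muI = 1 / Complex.sqrt (1 - lam ^ (2 * N)) *
      (2 + ∑ n ∈ Finset.Icc 1 (N - 1), (N.choose n : ℂ) *
        (1 - Complex.sqrt (1 - lam ^ (2 * n))) * ∫ x, returnV lam x ^ n ∂muI) := by
  have h := integral_returnV_pow hlam N
  have hs := sqrt_one_sub_ne_zero (norm_pow_lt_one hlam (N := 2 * N) (by omega))
  obtain ⟨M, rfl⟩ : ∃ M, N = M + 1 := ⟨N - 1, by omega⟩
  rw [Finset.sum_Icc_succ_top (by omega), Nat.choose_self, Nat.cast_one, one_mul] at h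
  rw [Nat.add_sub_cancel, one_div, eq_inv_mul_iff_mul_eq₀ hs]
  linear_combination h

/-! ### Determinant form of the recursion for the moments of `V` -/

theorem powEntry_zero (lam : ℂ) (k : ℕ) : powEntry lam k 0 = 1 := by simp [powEntry]

/-- Since `λ^{2m} = (1 - √(1 - λ^{2m}))(1 + √(1 - λ^{2m}))`, the entries are the coefficients of the
moment recursion with the unknown of index `k` moved across; for `m > k` the binomial coefficient
vanishes. -/
theorem powEntry_of_ne_zero {lam : ℂ} (hlam : ‖lam‖ < 1) (k : ℕ) {m : ℕ} (hm : m ≠ 0) :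
    powEntry lam k m =
      k.choose m * (1 - Complex.sqrt (1 - lam ^ (2 * m))) - if m = k then 1 else 0 := by
  have h1 : ‖lam ^ (2 * m)‖ < 1 := norm_pow_lt_one hlam (by omega)
  rw [powEntry, if_neg hm]
  split_ifs with h2 h3 h3
  · omega
  · rw [sub_zero, mul_div_assoc]
    congr 1
    rw [div_eq_iff (one_add_sqrt_ne_zero h1)]
    linear_combination sqrt_mul_self (1 - lam ^ (2 * m))
  · subst h3
    simp
  · rw [Nat.choose_eq_zero_of_lt (by omega)]
    simp

/-- The vector of moments is annihilated by the rows `1, …, N`, by the recursion, and the last row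
sends it to `∑ p_m ∫ V^m`. -/
theorem det_powMatrix {lam : ℂ} (hlam : ‖lam‖ < 1) (N : ℕ) (p : ℕ → ℂ) :
    2 * (powMatrix lam N p).det = (∏ n ∈ Finset.Icc 1 N, Complex.sqrt (1 - lam ^ (2 * n))) *
      ∑ m ∈ Finset.range (N + 1), p m * ∫ x, returnV lam x ^ m ∂muI := by
  set u : ℕ → ℂ := fun m => ∫ x, returnV lam x ^ m ∂muI with hu
  have hu0 : u 0 = 2 := by simp only [hu, pow_zero, integral_muI_one]
  have hA : (powMatrix lam N p).mulVec (fun m : Fin (N + 1) => u m) =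
      Pi.single (Fin.last N) (∑ m ∈ Finset.range (N + 1), p m * u m) := by
    funext i
    have hsum : (powMatrix lam N p).mulVec (fun m : Fin (N + 1) => u m) i =
        ∑ m ∈ Finset.range (N + 1),
          (if (i : ℕ) = N then p m else powEntry lam (i + 1) m) * u m :=
      (Finset.sum_range (fun m => (if (i : ℕ) = N then p m else powEntry lam (i + 1) m) * u m)).symm
    rw [hsum]
    by_cases hi : (i : ℕ) = N
    · have : i = Fin.last N := Fin.ext hi
      subst this
      simp
    · have hi' : i ≠ Fin.last N := fun h => hi (by simp [h])
      simp only [hi, if_false]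
      rw [Pi.single_eq_of_ne hi']
      have hk : (i : ℕ) + 1 ≤ N := by have := i.2; omega
      set k := (i : ℕ) + 1 with hkd
      rw [Finset.range_eq_Ico, Finset.sum_eq_sum_Ico_succ_bot (by omega), powEntry_zero, hu0]
      have h1 : ∑ m ∈ Finset.Ico (0 + 1) (N + 1), powEntry lam k m * u m =
          ∑ m ∈ Finset.Ico (0 + 1) (N + 1),
            (k.choose m * (1 - Complex.sqrt (1 - lam ^ (2 * m))) * u m -
              if m = k then u m else 0) := by
        refine Finset.sum_congr rfl fun m hm => ?_
        rw [Finset.mem_Ico] at hm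
        rw [powEntry_of_ne_zero hlam k (by omega)]
        split_ifs <;> ring
      have h2 : ∑ m ∈ Finset.Ico (0 + 1) (N + 1),
          (k.choose m : ℂ) * (1 - Complex.sqrt (1 - lam ^ (2 * m))) * u m =
          ∑ m ∈ Finset.Icc 1 k,
          (k.choose m : ℂ) * (1 - Complex.sqrt (1 - lam ^ (2 * m))) * u m := by
        symm
        refine Finset.sum_subset (fun m hm => ?_) fun m _ hm => ?_
        · rw [Finset.mem_Icc] at hm
          rw [Finset.mem_Ico]
          omega
        · rw [Finset.mem_Icc] at hm
          rename_i hm'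
          rw [Finset.mem_Ico] at hm'
          rw [Nat.choose_eq_zero_of_lt (by omega)]
          simp
      have h3 : u k = 2 + _ := integral_returnV_pow hlam k
      rw [h1, Finset.sum_sub_distrib, h2, Finset.sum_ite_eq', if_pos (by
        rw [Finset.mem_Ico]; omega), h3]
      ring
  -- Cramer's rule at index `0`: the zeroth moment is known to be `2`, and deleting column `0`
  -- leaves a triangular minor with diagonal `-√(1 - λ^{2n})`.
  have hd := det_mul_of_mulVec_eq_single hA 0
  have ht : ((powMatrix lam N p).submatrix Fin.castSucc (Fin.succAbove 0)).det =
      ∏ i : Fin N, -Complex.sqrt (1 - lam ^ (2 * ((i : ℕ) + 1))) := by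
    have he : ∀ i m : Fin N, ((powMatrix lam N p).submatrix Fin.castSucc (Fin.succAbove 0)) i m =
        powEntry lam (i + 1) (m + 1) := fun i m => by
      have := i.2.ne
      simp [powMatrix, this]
    rw [Matrix.det_of_isLowerTriangular]
    · refine Finset.prod_congr rfl fun i _ => ?_
      rw [he]
      simp [powEntry]
    · intro i m him
      rw [he]
      have him' : (i : ℕ) < m := him
      have h1 : ¬ (m : ℕ) < i := by omega
      have h2 : ¬ (m : ℕ) = i := by omega
      simp [powEntry, h1, h2]
  have hp : ∏ n ∈ Finset.Icc 1 N, Complex.sqrt (1 - lam ^ (2 * n)) =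
      ∏ i : Fin N, Complex.sqrt (1 - lam ^ (2 * ((i : ℕ) + 1))) := by
    rw [← Finset.prod_range (fun i => Complex.sqrt (1 - lam ^ (2 * (i + 1)))),
      Finset.range_eq_Ico, Finset.prod_Ico_add' (fun i => Complex.sqrt (1 - lam ^ (2 * i)))]
    rfl
  rw [ht, Finset.prod_neg, Finset.card_univ, Fintype.card_fin, ← hp] at hd
  simp only [Fin.val_zero, hu0, add_zero] at hd
  have hsq : ((-1 : ℂ) ^ N) * (-1) ^ N = 1 := by rw [← mul_pow]; simp
  linear_combination hd + (∏ n ∈ Finset.Icc 1 N, Complex.sqrt (1 - lam ^ (2 * n))) *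
    (∑ m ∈ Finset.range (N + 1), p m * u m) * hsq

theorem prod_sqrt_ne_zero {lam : ℂ} (hlam : ‖lam‖ < 1) (N : ℕ) :
    ∏ n ∈ Finset.Icc 1 N, Complex.sqrt (1 - lam ^ (2 * n)) ≠ 0 := by
  refine Finset.prod_ne_zero_iff.2 fun n hn => ?_
  rw [Finset.mem_Icc] at hn
  exact sqrt_one_sub_ne_zero (norm_pow_lt_one hlam (by omega))

theorem eval_eq_sum_of_natDegree_le {P : Polynomial ℂ} {N : ℕ} (hP : P.natDegree ≤ N) (y : ℂ) :
    P.eval y = ∑ m ∈ Finset.range (N + 1), P.coeff m * y ^ m :=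
  Polynomial.eval_eq_sum_range' (by omega) y

theorem integrable_eval_returnV {lam : ℂ} (hlam : ‖lam‖ < 1) (P : Polynomial ℂ) :
    Integrable (fun x => P.eval (returnV lam x)) muI := by
  simp_rw [Polynomial.eval_eq_sum_range]
  exact integrable_finsetSum _ fun n _ => (integrable_returnV_pow hlam n).const_mul _

theorem integral_eval_returnV {lam : ℂ} (hlam : ‖lam‖ < 1) {N : ℕ} {P : Polynomial ℂ}
    (hP : P.natDegree ≤ N) :
    ∫ x, P.eval (returnV lam x) ∂muI =
      2 / (∏ n ∈ Finset.Icc 1 N, Complex.sqrt (1 - lam ^ (2 * n))) *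
        (powMatrix lam N P.coeff).det := by
  rw [div_mul_eq_mul_div, det_powMatrix hlam, mul_div_cancel_left₀ _ (prod_sqrt_ne_zero hlam N)]
  simp_rw [eval_eq_sum_of_natDegree_le hP]
  rw [integral_finsetSum _ fun n _ => (integrable_returnV_pow hlam n).const_mul _]
  simp_rw [integral_const_mul]

theorem det_powMatrix_X_pow (lam : ℂ) (N : ℕ) :
    (powMatrix lam N (Polynomial.X ^ N : Polynomial ℂ).coeff).det = (powMatrix' lam N).det := by
  rw [det_eq_of_last_row (Fin.last N) fun j hj => ?_]
  · have h1 : (-1 : ℂ) ^ (N + ((Fin.last N : Fin (N + 1)) : ℕ)) = 1 := by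
      rw [Fin.val_last, ← two_mul, pow_mul]; simp
    rw [h1, Fin.succAbove_last]
    have h2 : powMatrix lam N (Polynomial.X ^ N : Polynomial ℂ).coeff (Fin.last N) (Fin.last N) =
        1 := by simp [powMatrix]
    rw [h2, one_mul, one_mul]
    congr 1
    ext i m
    simp [powMatrix, powMatrix', i.2.ne]
  · have : (j : ℕ) ≠ N := fun h => hj (Fin.ext h)
    simp [powMatrix, Polynomial.coeff_X_pow, this]

/-! ### The Fourier transform of `V` -/

theorem integral_exp_muI (w : ℂ) : ∫ x : ℝ, cexp (I * w * x) ∂muI = 2 * csinc w := by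
  rw [integral_muI, csinc]
  split_ifs with hw
  · subst hw
    simp
    norm_num
  · rw [integral_exp_mul_complex (mul_ne_zero I_ne_zero hw), Complex.sin]
    field_simp
    push_cast
    rw [I_sq, mul_one, mul_neg_one, mul_comm I w, neg_mul]
    ring

theorem integrable_exp_muI (w : ℂ) : Integrable (fun x : ℝ => cexp (I * w * x)) muI :=
  integrable_muI_iff.2 ((by fun_prop : Continuous _).intervalIntegrable _ _)

theorem csinc_neg (w : ℂ) : csinc (-w) = csinc w := by
  simp [csinc, Complex.sin_neg]

theorem csinc_eq_mul_cos (w : ℂ) : csinc w = csinc (w / 2) * Complex.cos (w / 2) := by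
  by_cases hw : w = 0
  · simp [csinc, hw]
  · have h2 : w / 2 ≠ 0 := div_ne_zero hw two_ne_zero
    rw [csinc, csinc, if_neg hw, if_neg h2]
    have : Complex.sin w = 2 * Complex.sin (w / 2) * Complex.cos (w / 2) := by
      rw [← Complex.sin_two_mul]
      congr 1
      ring
    rw [this]
    field_simp

theorem norm_exp_I_mul_le (w : ℂ) {x : ℝ} (hx : |x| ≤ 1) : ‖cexp (I * w * x)‖ ≤ Real.exp ‖w‖ := by
  refine (norm_exp_le_exp_norm _).trans (Real.exp_le_exp.2 ?_)
  rw [norm_mul, norm_mul, norm_I, one_mul, norm_real, Real.norm_eq_abs]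
  exact mul_le_of_le_one_right (norm_nonneg _) hx

theorem norm_integral_mul_exp_le {f : ℝ → ℂ} {C : ℝ} (hC : ∀ x, ‖f x‖ ≤ C) (w : ℂ) :
    ‖∫ x : ℝ, f x * cexp (I * w * x) ∂muI‖ ≤ C * Real.exp ‖w‖ * muI.real Set.univ := by
  refine norm_integral_le_of_norm_le_const (ae_muI_mem.mono fun x hx => ?_)
  rw [norm_mul]
  exact mul_le_mul (hC x) (norm_exp_I_mul_le w (abs_le.2 ⟨hx.1.le, hx.2.le⟩)) (norm_nonneg _)
    ((norm_nonneg _).trans (hC x))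

theorem muI_real_univ : muI.real Set.univ = 2 := by
  simp [muI, Measure.real, Real.volume_Ioo]
  norm_num

/-- `csinc w` is the mean of `e^{iwx}` over `(-1, 1)`. -/
theorem norm_csinc_le (w : ℂ) : ‖csinc w‖ ≤ Real.exp ‖w‖ := by
  have h := norm_integral_mul_exp_le (f := fun _ => 1) (C := 1) (by simp) w
  simp only [one_mul, integral_exp_muI, norm_mul, muI_real_univ] at h
  rw [Complex.norm_ofNat] at h
  linarith

theorem norm_cos_add_le (φ : ℝ) (w : ℂ) : ‖Complex.cos (φ + w)‖ ≤ Real.exp ‖w‖ := by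
  have h : ∀ e : ℝ, |e| ≤ 1 → ‖cexp (e * (φ + w) * I)‖ ≤ Real.exp ‖w‖ := fun e he => by
    have : e * (φ + w) * I = ((e * φ : ℝ) : ℂ) * I + I * w * e := by push_cast; ring
    rw [this, Complex.exp_add, norm_mul, norm_exp_ofReal_mul_I, one_mul]
    exact norm_exp_I_mul_le w he
  have h1 := h 1 (by simp)
  have h2 := h (-1) (by simp)
  rw [Complex.cos, norm_div, Complex.norm_ofNat, div_le_iff₀ two_pos]
  push_cast at h1 h2
  rw [one_mul] at h1
  rw [neg_one_mul] at h2
  exact (norm_add_le _ _).trans (by linarith)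

theorem norm_prod_cos_le (φ : ℝ) (ω : ℂ) (n : ℕ) :
    ‖∏ j ∈ Finset.Icc 1 n, Complex.cos (φ + ω / 2 ^ j)‖ ≤ Real.exp ‖ω‖ := by
  -- The sharper exponent is the partial sum of `∑ |ω|/2^j`; it makes the induction close.
  have h : ‖∏ j ∈ Finset.Icc 1 n, Complex.cos (φ + ω / 2 ^ j)‖ ≤
      Real.exp (‖ω‖ * (1 - 1 / 2 ^ n)) := by
    induction n with
    | zero => simp
    | succ n ih =>
      rw [Finset.prod_Icc_succ_top (by omega), norm_mul]
      refine (mul_le_mul ih (norm_cos_add_le φ _) (norm_nonneg _) (Real.exp_nonneg _)).trans ?_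
      rw [← Real.exp_add, norm_div, norm_pow, Complex.norm_ofNat]
      refine Real.exp_le_exp.2 (le_of_eq ?_)
      field_simp
      ring
  refine h.trans (Real.exp_le_exp.2 (mul_le_of_le_one_right (norm_nonneg _) ?_))
  have : (0 : ℝ) ≤ 1 / 2 ^ n := by positivity
  linarith

theorem norm_div_two_pow_le (ω : ℂ) (n : ℕ) : ‖ω / 2 ^ n‖ ≤ ‖ω‖ := by
  rw [norm_div, norm_pow, Complex.norm_ofNat]
  exact div_le_self (norm_nonneg _) (one_le_pow₀ one_le_two)

theorem norm_fourierTerm_le (lam : ℂ) (φ : ℝ) (ω : ℂ) (n : ℕ) :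
    ‖fourierTerm lam φ ω n‖ ≤ ‖lam‖ ^ n * (Real.exp ‖ω‖ * Real.exp ‖ω‖) := by
  rw [fourierTerm, norm_mul, norm_mul, norm_pow, mul_assoc]
  refine mul_le_mul_of_nonneg_left ?_ (by positivity)
  exact mul_le_mul ((norm_csinc_le _).trans (Real.exp_le_exp.2 (norm_div_two_pow_le ω n)))
    (norm_prod_cos_le φ ω n) (norm_nonneg _) (Real.exp_nonneg _)

theorem summable_fourierBound {lam : ℂ} (hlam : ‖lam‖ < 1) (ω : ℂ) :
    Summable fun n => ‖lam‖ ^ n * (Real.exp ‖ω‖ * Real.exp ‖ω‖) :=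
  (summable_geometric_of_lt_one (norm_nonneg lam) hlam).mul_right _

theorem summable_fourierTerm {lam : ℂ} (hlam : ‖lam‖ < 1) (φ : ℝ) (ω : ℂ) :
    Summable (fourierTerm lam φ ω) :=
  Summable.of_norm_bounded (summable_fourierBound hlam ω) (norm_fourierTerm_le lam φ ω)

theorem continuous_fourierC {lam : ℂ} (hlam : ‖lam‖ < 1) (ω : ℂ) :
    Continuous fun φ => fourierC lam φ ω := by
  unfold fourierC
  refine continuous_tsum (fun n => ?_) (summable_fourierBound hlam ω)
    fun n φ => norm_fourierTerm_le lam φ ω n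
  unfold fourierTerm
  fun_prop

/-- With the symmetry of `[-π, π]`, this makes the integrals of `V` against `e^{iωx}` and `e^{-iωx}`
equal, so the cosine transform needs only one of them. -/
theorem fourierC_neg (lam : ℂ) (φ : ℝ) (ω : ℂ) : fourierC lam φ (-ω) = fourierC lam (-φ) ω := by
  unfold fourierC fourierTerm
  refine tsum_congr fun n => ?_
  rw [neg_div, csinc_neg]
  congr 1
  refine Finset.prod_congr rfl fun j _ => ?_
  rw [← Complex.cos_neg]
  congr 1
  push_cast
  ring

/-- `R_±` sends `e^{iωx}` to `e^{±iω/2} e^{iωx/2}`, and the two phases combine to `cos (φ + ω/2)`.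
-/
theorem integral_walkSeries_exp {lam : ℂ} (hlam : ‖lam‖ < 1) (φ : ℝ) (ω : ℂ) :
    ∫ x : ℝ, walkSeries lam φ x * cexp (I * ω * x) ∂muI = 2 * csinc ω +
      lam * Complex.cos (φ + ω / 2) *
        ∫ x : ℝ, walkSeries lam φ x * cexp (I * (ω / 2) * x) ∂muI := by
  rw [integral_walkSeries_mul hlam φ (integrable_exp_muI ω), integral_exp_muI]
  have e1 : ∀ e : ℝ, ∫ x : ℝ, walkSeries lam φ x * cexp (I * ω * ((x + e) / 2 : ℝ)) ∂muI =
      cexp (I * ω * e / 2) * ∫ x : ℝ, walkSeries lam φ x * cexp (I * (ω / 2) * x) ∂muI := by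
    intro e
    rw [← integral_const_mul]
    congr 1
    funext x
    have : I * ω * ((x + e) / 2 : ℝ) = I * ω * e / 2 + I * (ω / 2) * x := by
      push_cast; ring
    rw [this, Complex.exp_add]
    ring
  rw [e1, e1, Complex.cos]
  have h1 : cexp ((φ + ω / 2) * I) = cexp (I * φ) * cexp (I * ω * (1 : ℝ) / 2) := by
    rw [← Complex.exp_add]; congr 1; push_cast; ring
  have h2 : cexp (-(φ + ω / 2) * I) = cexp (-(I * φ)) * cexp (I * ω * (-1 : ℝ) / 2) := by
    rw [← Complex.exp_add]; congr 1; push_cast; ring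
  rw [h1, h2]
  ring

theorem integral_walkSeries_exp_iterate {lam : ℂ} (hlam : ‖lam‖ < 1) (φ : ℝ) (ω : ℂ) (n : ℕ) :
    ∫ x : ℝ, walkSeries lam φ x * cexp (I * ω * x) ∂muI =
      2 * ∑ k ∈ Finset.range n, fourierTerm lam φ ω k +
        lam ^ n * (∏ j ∈ Finset.Icc 1 n, Complex.cos (φ + ω / 2 ^ j)) *
          ∫ x : ℝ, walkSeries lam φ x * cexp (I * (ω / 2 ^ n) * x) ∂muI := by
  induction n with
  | zero => simp
  | succ n ih =>
    rw [ih, integral_walkSeries_exp hlam φ (ω / 2 ^ n), Finset.sum_range_succ,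
      Finset.prod_Icc_succ_top (by omega), fourierTerm, div_div, ← pow_succ]
    ring

/-- The remainder of the iteration is `O(|λ|^n)`, as the cosine products and the integrals at
frequency `ω/2^n` are bounded uniformly in `n`. -/
theorem integral_walkSeries_exp_eq {lam : ℂ} (hlam : ‖lam‖ < 1) (φ : ℝ) (ω : ℂ) :
    ∫ x : ℝ, walkSeries lam φ x * cexp (I * ω * x) ∂muI = 2 * fourierC lam φ ω := by
  set R : ℕ → ℂ := fun n => lam ^ n * (∏ j ∈ Finset.Icc 1 n, Complex.cos (φ + ω / 2 ^ j)) *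
          ∫ x : ℝ, walkSeries lam φ x * cexp (I * (ω / 2 ^ n) * x) ∂muI with hR
  have hR0 : Tendsto R atTop (𝓝 0) := by
    have hb : ∀ n, ‖R n‖ ≤ ‖lam‖ ^ n * (Real.exp ‖ω‖ *
        ((1 - ‖lam‖)⁻¹ * Real.exp ‖ω‖ * muI.real Set.univ)) := fun n => by
      rw [hR]
      simp only [norm_mul, norm_pow]
      rw [mul_assoc]
      refine mul_le_mul_of_nonneg_left ?_ (by positivity)
      refine mul_le_mul (norm_prod_cos_le φ ω n) ?_ (norm_nonneg _) (Real.exp_nonneg _)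
      refine (norm_integral_mul_exp_le (norm_walkSeries_le hlam φ) _).trans ?_
      have h0 : 0 ≤ (1 - ‖lam‖)⁻¹ := inv_nonneg.2 (by linarith)
      have h1 := Real.exp_le_exp.2 (norm_div_two_pow_le ω n)
      rw [muI_real_univ]
      gcongr
    refine squeeze_zero_norm hb ?_
    simpa using (tendsto_pow_atTop_nhds_zero_of_lt_one (norm_nonneg lam) hlam).mul_const
      (Real.exp ‖ω‖ * ((1 - ‖lam‖)⁻¹ * Real.exp ‖ω‖ * muI.real Set.univ))
  have h1 := (((summable_fourierTerm hlam φ ω).hasSum.tendsto_sum_nat).const_mul 2).add hR0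
  have h2 := tendsto_nhds_unique (tendsto_const_nhds.congr
    (integral_walkSeries_exp_iterate hlam φ ω)) h1
  rw [h2, add_zero, fourierC]

theorem integral_returnV_exp {lam : ℂ} (hlam : ‖lam‖ < 1) (ω : ℂ) :
    ∫ x : ℝ, returnV lam x * cexp (I * ω * x) ∂muI =
      1 / Real.pi * ∫ φ in (-Real.pi)..Real.pi, fourierC lam φ ω := by
  rw [integral_returnV_mul hlam (-Real.pi) (integrable_exp_muI ω)]
  simp_rw [integral_walkSeries_exp_eq hlam]
  rw [intervalIntegral.integral_const_mul, show -Real.pi + 2 * Real.pi = Real.pi by ring]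
  have : (Real.pi : ℂ) ≠ 0 := by exact_mod_cast Real.pi_ne_zero
  field_simp

theorem integral_returnV_cos {lam : ℂ} (hlam : ‖lam‖ < 1) (ω : ℂ) :
    ∫ x : ℝ, returnV lam x * Complex.cos (ω * x) ∂muI =
      1 / Real.pi * ∫ φ in (-Real.pi)..Real.pi, fourierC lam φ ω := by
  have h : ∀ x : ℝ, returnV lam x * Complex.cos (ω * x) =
      (returnV lam x * cexp (I * ω * x) + returnV lam x * cexp (I * -ω * x)) / 2 := fun x => by
    rw [Complex.cos, show ω * x * I = I * ω * x by ring, show -(ω * x) * I = I * -ω * x by ring]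
    ring
  simp_rw [h]
  rw [integral_div, integral_add (integrable_returnV_mul hlam (integrable_exp_muI ω))
    (integrable_returnV_mul hlam (integrable_exp_muI (-ω))), integral_returnV_exp hlam,
    integral_returnV_exp hlam]
  simp_rw [fourierC_neg]
  rw [intervalIntegral.integral_comp_neg (fun φ => fourierC lam φ ω), neg_neg]
  ring

/-! ### The continued fraction -/

/-- The ratio of consecutive terms, written without division: the duplication formula for the sine
supplies `γ_{n+1}`. This is the input to Euler's continued fraction. -/
theorem fourierTerm_succ_mul (lam : ℂ) (φ : ℝ) (ω : ℂ) (n : ℕ) :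
    fourierTerm lam φ ω (n + 1) * Complex.cos (ω / 2 ^ (n + 1)) =
      fourierTerm lam φ ω n * (lam * Complex.cos (φ + ω / 2 ^ (n + 1))) := by
  rw [fourierTerm, fourierTerm, Finset.prod_Icc_succ_top (by omega), csinc_eq_mul_cos (ω / 2 ^ n),
    div_div, ← pow_succ]
  ring

theorem fourierCF_get (lam : ℂ) (φ : ℝ) (ω : ℂ) (n : ℕ) :
    (fourierCF lam φ ω).s.get? n = some (fourierCFPair lam φ ω n) := rfl

/-- In `B_{n+3} = (γ_{n+2} + δ_{n+2}) B_{n+2} - γ_{n+1} δ_{n+2} B_{n+1}` the `δ`-terms cancel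
because `B_{n+2} = γ_{n+1} B_{n+1}`. -/
theorem fourierCF_dens_succ (lam : ℂ) (φ : ℝ) (ω : ℂ) (n : ℕ) :
    (fourierCF lam φ ω).dens (n + 1) = ∏ j ∈ Finset.Icc 1 n, Complex.cos (ω / 2 ^ j) := by
  have h1 : (fourierCF lam φ ω).dens 1 = 1 :=
    GenContFract.first_den_eq (fourierCF_get lam φ ω 0)
  induction n using Nat.twoStepInduction with
  | zero => simp [h1]
  | one =>
    rw [GenContFract.dens_recurrence (fourierCF_get lam φ ω 1) GenContFract.zeroth_den_eq_one h1]
    simp [fourierCFPair]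
  | more n ih1 ih2 =>
    rw [GenContFract.dens_recurrence (fourierCF_get lam φ ω (n + 2)) ih1 ih2,
      Finset.prod_Icc_succ_top (by omega), Finset.prod_Icc_succ_top (by omega),
      Finset.prod_Icc_succ_top (by omega)]
    simp only [fourierCFPair]
    ring

/-- Over the product form of the denominators, this identifies the convergents, times `csinc ω`,
with the partial sums of `C`. -/
theorem csinc_mul_fourierCF_nums_succ (lam : ℂ) (φ : ℝ) (ω : ℂ) (n : ℕ) :
    csinc ω * (fourierCF lam φ ω).nums (n + 1) =
      (∏ j ∈ Finset.Icc 1 n, Complex.cos (ω / 2 ^ j)) *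
        ∑ k ∈ Finset.range (n + 1), fourierTerm lam φ ω k := by
  have h1 : (fourierCF lam φ ω).nums 1 = 1 := by
    rw [GenContFract.first_num_eq (fourierCF_get lam φ ω 0)]
    simp [fourierCFPair, fourierCF]
  have h0 : (fourierCF lam φ ω).nums 0 = 0 := by
    rw [GenContFract.zeroth_num_eq_h]
    rfl
  have hT := fourierTerm_succ_mul lam φ ω
  induction n using Nat.twoStepInduction with
  | zero => simp [h1, fourierTerm]
  | one =>
    rw [GenContFract.nums_recurrence (fourierCF_get lam φ ω 1) h0 h1]
    have h2 := hT 0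
    have h3 : fourierTerm lam φ ω 0 = csinc ω := by simp [fourierTerm]
    simp only [fourierCFPair, Finset.sum_range_succ, Finset.range_zero, Finset.sum_empty, h3,
      Finset.Icc_self, Finset.prod_singleton, zero_add, pow_one] at h2 ⊢
    linear_combination -h2
  | more n ih1 ih2 =>
    rw [GenContFract.nums_recurrence (fourierCF_get lam φ ω (n + 2)) rfl rfl]
    have h2 := hT (n + 1)
    rw [Finset.prod_Icc_succ_top (by omega)] at ih2 ⊢
    rw [Finset.sum_range_succ] at ih2
    rw [Finset.prod_Icc_succ_top (by omega), Finset.sum_range_succ, Finset.sum_range_succ]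
    simp only [fourierCFPair, add_assoc, Nat.reduceAdd] at *
    linear_combination (Complex.cos (ω / 2 ^ (n + 2)) +
      lam * Complex.cos (φ + ω / 2 ^ (n + 2))) * ih2 -
      lam * Complex.cos (ω / 2 ^ (n + 1)) * Complex.cos (φ + ω / 2 ^ (n + 2)) * ih1 -
      (∏ j ∈ Finset.Icc 1 n, Complex.cos (ω / 2 ^ j)) * Complex.cos (ω / 2 ^ (n + 1)) * h2

theorem cos_div_two_pow_ne_zero {ω : ℂ} (hω : ∀ k : ℤ, k ≠ 0 → ω ≠ k * Real.pi) {j : ℕ}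
    (hj : 1 ≤ j) : Complex.cos (ω / 2 ^ j) ≠ 0 := by
  intro h
  obtain ⟨k, hk⟩ := Complex.cos_eq_zero_iff.1 h
  obtain ⟨i, rfl⟩ : ∃ i, j = i + 1 := ⟨j - 1, by omega⟩
  -- A zero of `cos (ω/2^j)` forces `ω = 2^{j-1} (2k + 1) π`, a nonzero multiple of `π`.
  refine hω (2 ^ i * (2 * k + 1)) (mul_ne_zero (by positivity) (by omega)) ?_
  rw [div_eq_iff (pow_ne_zero _ two_ne_zero)] at hk
  rw [hk]
  push_cast
  ring

theorem fourierCF_dens_ne_zero (lam : ℂ) (φ : ℝ) {ω : ℂ}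
    (hω : ∀ k : ℤ, k ≠ 0 → ω ≠ k * Real.pi) (n : ℕ) : (fourierCF lam φ ω).dens n ≠ 0 := by
  cases n with
  | zero => rw [GenContFract.zeroth_den_eq_one]; exact one_ne_zero
  | succ n =>
    rw [fourierCF_dens_succ]
    exact Finset.prod_ne_zero_iff.2 fun j hj =>
      cos_div_two_pow_ne_zero hω (Finset.mem_Icc.1 hj).1

theorem tendsto_fourierCF_convs {lam : ℂ} (hlam : ‖lam‖ < 1) (φ : ℝ) {ω : ℂ}
    (hω : ∀ k : ℤ, k ≠ 0 → ω ≠ k * Real.pi) :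
    Tendsto (fun n : ℕ => csinc ω * (fourierCF lam φ ω).convs n) atTop
      (𝓝 (fourierC lam φ ω)) := by
  rw [← tendsto_add_atTop_iff_nat 1]
  refine ((tendsto_add_atTop_iff_nat 1).2
    (summable_fourierTerm hlam φ ω).hasSum.tendsto_sum_nat).congr fun n => ?_
  have h := fourierCF_dens_ne_zero lam φ hω (n + 1)
  rw [GenContFract.conv_eq_num_div_den, ← mul_div_assoc, csinc_mul_fourierCF_nums_succ,
    ← fourierCF_dens_succ lam φ, mul_div_cancel_left₀ _ h]

/-! ### Moments of the generating series -/

theorem integrable_pow_muI (k : ℕ) : Integrable (fun x : ℝ => (x : ℂ) ^ k) muI :=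
  integrable_muI_iff.2 ((by fun_prop : Continuous _).intervalIntegrable _ _)

theorem integral_pow_muI (k : ℕ) : ∫ x : ℝ, (x : ℂ) ^ k ∂muI = 2 * momLast k / 2 ^ k := by
  rw [integral_muI]
  have h : ∫ x in (-1 : ℝ)..1, (x : ℂ) ^ k = ((∫ x in (-1 : ℝ)..1, x ^ k : ℝ) : ℂ) := by
    rw [← intervalIntegral.integral_ofReal]
    push_cast
    rfl
  have hk : (k : ℂ) + 1 ≠ 0 := by exact_mod_cast k.succ_ne_zero
  rw [h, integral_pow, momLast]
  split_ifs with hE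
  · rw [hE.add_one.neg_one_pow]
    push_cast
    field_simp
    ring
  · rw [(Nat.not_even_iff_odd.1 hE).add_one.neg_one_pow]
    simp

/-- The coefficient of the operator `z⁻¹ R_- + z R_+` between powers of different parities: `u`
if the parities agree, and `v` otherwise. -/
def parityCoeff {R : Type*} (u v : R) (k m : ℕ) : R := if Even (k + m) then u else v

/-- The moments `∫ W_φ(x) x ^ k dx`. -/
def walkMoment (lam : ℂ) (k : ℕ) (φ : ℝ) : ℂ := ∫ x : ℝ, walkSeries lam φ x * (x : ℂ) ^ k ∂muI

theorem integral_walkSeries_affine_pow {lam : ℂ} (hlam : ‖lam‖ < 1) (φ e : ℝ) (k : ℕ) :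
    ∫ x : ℝ, walkSeries lam φ x * (((x + e) / 2 : ℝ) : ℂ) ^ k ∂muI =
      (∑ m ∈ Finset.range (k + 1), (k.choose m : ℂ) * e ^ (k - m) * walkMoment lam m φ) /
        2 ^ k := by
  have h : ∀ x : ℝ, walkSeries lam φ x * (((x + e) / 2 : ℝ) : ℂ) ^ k =
      (∑ m ∈ Finset.range (k + 1), (k.choose m : ℂ) * e ^ (k - m) *
        (walkSeries lam φ x * (x : ℂ) ^ m)) / 2 ^ k := fun x => by
    push_cast
    rw [div_pow, add_pow, mul_div_assoc', Finset.mul_sum]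
    congr 1
    exact Finset.sum_congr rfl fun m _ => by ring
  simp_rw [h]
  rw [integral_div, integral_finsetSum _ fun m _ =>
    (integrable_walkSeries_mul hlam φ (integrable_pow_muI m)).const_mul _]
  simp_rw [integral_const_mul]
  rfl

/-- Expand `((x ± 1)/2)^k` binomially: the phases combine as `e^{iφ} + (-1)^{k-m} e^{-iφ}`, which is
`2 cos φ` or `2i sin φ` by the parity of `k - m`. The term `m = k` goes to the left side. -/
theorem walkMoment_recurrence {lam : ℂ} (hlam : ‖lam‖ < 1) (k : ℕ) (φ : ℝ) :
    (2 ^ k - lam * Complex.cos φ) * walkMoment lam k φ = 2 * momLast k +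
      ∑ m ∈ Finset.range k, (k.choose m : ℂ) *
        parityCoeff (lam * Complex.cos φ) (lam * (I * Complex.sin φ)) k m *
          walkMoment lam m φ := by
  have h := integral_walkSeries_mul hlam φ (integrable_pow_muI k)
  rw [integral_walkSeries_affine_pow hlam, integral_walkSeries_affine_pow hlam,
    integral_pow_muI] at h
  have h2 : (2 : ℂ) ^ k ≠ 0 := pow_ne_zero _ two_ne_zero
  have hc : Complex.cos φ = (cexp (I * φ) + cexp (-(I * φ))) / 2 := by
    rw [Complex.cos, mul_comm I, neg_mul]
  have hs : I * Complex.sin φ = (cexp (I * φ) - cexp (-(I * φ))) / 2 := by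
    rw [Complex.sin, mul_comm I (φ : ℂ), neg_mul]
    linear_combination (cexp (-(φ * I)) - cexp (φ * I)) / 2 * I_sq
  have h3 : ∑ m ∈ Finset.range (k + 1), (k.choose m : ℂ) *
        parityCoeff (lam * Complex.cos φ) (lam * (I * Complex.sin φ)) k m * walkMoment lam m φ =
      lam / 2 * (cexp (-(I * φ)) * (∑ m ∈ Finset.range (k + 1),
          (k.choose m : ℂ) * ((-1 : ℝ) : ℂ) ^ (k - m) * walkMoment lam m φ) +
        cexp (I * φ) * (∑ m ∈ Finset.range (k + 1),
          (k.choose m : ℂ) * ((1 : ℝ) : ℂ) ^ (k - m) * walkMoment lam m φ)) := by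
    rw [Finset.mul_sum, Finset.mul_sum, ← Finset.sum_add_distrib, Finset.mul_sum]
    refine Finset.sum_congr rfl fun m hm => ?_
    have hmk : m ≤ k := Nat.lt_succ_iff.1 (Finset.mem_range.1 hm)
    have hpar : Even (k + m) ↔ Even (k - m) := by
      rw [Nat.even_sub hmk, Nat.even_add]
    rw [parityCoeff]
    push_cast
    split_ifs with hE
    · rw [(hpar.1 hE).neg_one_pow, hc]
      ring
    · rw [(Nat.not_even_iff_odd.1 (fun h => hE (hpar.2 h))).neg_one_pow, hs]
      ring
  rw [Finset.sum_range_succ, Nat.choose_self, Nat.cast_one, one_mul, parityCoeff,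
    if_pos ⟨k, rfl⟩] at h3
  have h4 : walkMoment lam k φ = 2 * momLast k / 2 ^ k + lam / 2 *
      (cexp (-(I * φ)) * ((∑ m ∈ Finset.range (k + 1),
          (k.choose m : ℂ) * ((-1 : ℝ) : ℂ) ^ (k - m) * walkMoment lam m φ) / 2 ^ k) +
        cexp (I * φ) * ((∑ m ∈ Finset.range (k + 1),
          (k.choose m : ℂ) * ((1 : ℝ) : ℂ) ^ (k - m) * walkMoment lam m φ) / 2 ^ k)) := h
  have h5 : 2 ^ k * walkMoment lam k φ = 2 * momLast k + lam / 2 *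
      (cexp (-(I * φ)) * (∑ m ∈ Finset.range (k + 1),
          (k.choose m : ℂ) * ((-1 : ℝ) : ℂ) ^ (k - m) * walkMoment lam m φ) +
        cexp (I * φ) * (∑ m ∈ Finset.range (k + 1),
          (k.choose m : ℂ) * ((1 : ℝ) : ℂ) ^ (k - m) * walkMoment lam m φ)) := by
    conv_lhs => rw [h4]
    field_simp
  linear_combination h5 - h3

theorem mul_cos_ne_two_pow {lam : ℂ} (hlam : ‖lam‖ < 1) (φ : ℝ) (k : ℕ) :
    lam * Complex.cos φ ≠ 2 ^ k := fun h => by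
  have h1 := norm_mul_cos_le lam φ
  rw [h, norm_pow, Complex.norm_ofNat] at h1
  have h2 : (1 : ℝ) ≤ 2 ^ k := one_le_pow₀ one_le_two
  linarith

/-- Changing the sign of `φ` changes only the sine coefficients, which couple moments of opposite
parity, while the inhomogeneous term vanishes for odd `k`. -/
theorem walkMoment_neg {lam : ℂ} (hlam : ‖lam‖ < 1) (k : ℕ) (φ : ℝ) :
    walkMoment lam k (-φ) = (-1) ^ k * walkMoment lam k φ := by
  induction k using Nat.strong_induction_on with
  | _ k ih =>
    have h1 := walkMoment_recurrence hlam k φ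
    have h2 := walkMoment_recurrence hlam k (-φ)
    have h0 := sub_ne_zero.2 (mul_cos_ne_two_pow hlam φ k).symm
    push_cast at h2
    rw [Complex.cos_neg, Complex.sin_neg] at h2
    refine mul_left_cancel₀ h0 ?_
    rw [h2, mul_left_comm (2 ^ k - lam * Complex.cos φ), h1, mul_add, Finset.mul_sum]
    congr 1
    · rw [momLast]
      split_ifs with hE
      · rw [hE.neg_one_pow, one_mul]
      · simp
    · refine Finset.sum_congr rfl fun m hm => ?_
      rw [ih m (Finset.mem_range.1 hm), parityCoeff, parityCoeff]
      have hsq : ((-1 : ℂ) ^ m) * (-1) ^ m = 1 := by rw [← mul_pow]; simp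
      have hpow : (-1 : ℂ) ^ k = (-1) ^ (k + m) * (-1) ^ m := by
        rw [pow_add, mul_assoc, hsq, mul_one]
      rw [hpow]
      split_ifs with hE
      · rw [hE.neg_one_pow]; ring
      · rw [(Nat.not_even_iff_odd.1 hE).neg_one_pow]; ring

theorem intervalIntegral_eq_zero_of_odd {f : ℝ → ℂ} (hf : ∀ x, f (-x) = -f x) (a : ℝ) :
    ∫ x in (-a)..a, f x = 0 := by
  have h := intervalIntegral.integral_comp_neg (a := -a) (b := a) f
  simp_rw [hf] at h
  rw [intervalIntegral.integral_neg, neg_neg] at h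
  linear_combination (-1 / 2 : ℂ) * h

theorem integral_returnV_mul_pow {lam : ℂ} (hlam : ‖lam‖ < 1) (k : ℕ) :
    ∫ x : ℝ, returnV lam x * (x : ℂ) ^ k ∂muI =
      (2 * Real.pi : ℂ)⁻¹ * ∫ φ in (-Real.pi)..Real.pi, walkMoment lam k φ := by
  rw [integral_returnV_mul hlam (-Real.pi) (integrable_pow_muI k),
    show -Real.pi + 2 * Real.pi = Real.pi by ring]
  rfl

theorem integral_returnV_mul_pow_of_odd {lam : ℂ} (hlam : ‖lam‖ < 1) {k : ℕ} (hk : Odd k) :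
    ∫ x : ℝ, returnV lam x * (x : ℂ) ^ k ∂muI = 0 := by
  rw [integral_returnV_mul_pow hlam, intervalIntegral_eq_zero_of_odd fun φ => ?_, mul_zero]
  rw [walkMoment_neg hlam, hk.neg_one_pow, neg_one_mul]

/-! ### The bordered triangular determinant -/

/-- A triangular matrix with the last column `c` and the last row `-p`. -/
def borderedMatrix {R : Type*} [CommRing R] (N : ℕ) (u v : R) (p c : ℕ → R) :
    Matrix (Fin (N + 2)) (Fin (N + 2)) R :=
  Matrix.of fun i m =>
    if (i : ℕ) = N + 1 then (if (m : ℕ) = N + 1 then 0 else -p m)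
    else if (m : ℕ) = N + 1 then c i
    else if (m : ℕ) < i then ((i : ℕ).choose m : R) * parityCoeff u v i m
    else if (m : ℕ) = i then u - 2 ^ (i : ℕ) else 0

/-- Allows one determinant over `ℂ[u, v]` to be specialised both at `(λ cos φ, iλ sin φ)` and at the
poles. -/
theorem map_det_borderedMatrix {R S : Type*} [CommRing R] [CommRing S] (f : R →+* S) (N : ℕ)
    (u v : R) (p c : ℕ → R) :
    f (borderedMatrix N u v p c).det =
      (borderedMatrix N (f u) (f v) (fun m => f (p m)) (fun k => f (c k))).det := by
  rw [RingHom.map_det]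
  congr 1
  ext i m
  simp only [RingHom.mapMatrix_apply, Matrix.map_apply, borderedMatrix, Matrix.of_apply,
    parityCoeff]
  have h2 : f 2 = 2 := map_ofNat f 2
  split_ifs <;> simp [h2]

/-- Entries outside the last row and column have degree at most one, those inside are constant, and
the corner is `0`. A nonzero Leibniz term thus uses two distinct border entries and only `N` others.
This bound makes the partial fractions proper. -/
theorem totalDegree_det_borderedMatrix (N : ℕ) (p c : ℕ → ℂ) :
    (borderedMatrix N (MvPolynomial.X 0) (MvPolynomial.X 1) (fun m => MvPolynomial.C (p m))
      (fun k => MvPolynomial.C (c k)) : Matrix _ _ (MvPolynomial (Fin 2) ℂ)).det.totalDegree ≤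
      N := by
  set M : Matrix (Fin (N + 2)) (Fin (N + 2)) (MvPolynomial (Fin 2) ℂ) :=
    borderedMatrix N (MvPolynomial.X 0) (MvPolynomial.X 1) (fun m => MvPolynomial.C (p m))
      (fun k => MvPolynomial.C (c k)) with hM
  set l := Fin.last (N + 1) with hl
  have hlv : ∀ i : Fin (N + 2), (i : ℕ) = N + 1 ↔ i = l := fun i => by
    rw [Fin.ext_iff, hl, Fin.val_last]
  have hdeg : ∀ i m, (M i m).totalDegree ≤ if i ≠ l ∧ m ≠ l then 1 else 0 := by
    intro i m
    by_cases hi : i = l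
    · have : (M i m) = MvPolynomial.C (if m = l then 0 else -p m) := by
        simp only [hM, borderedMatrix, Matrix.of_apply, hlv, hi, if_true]
        split_ifs <;> simp
      rw [this, MvPolynomial.totalDegree_C]
      exact Nat.zero_le _
    · by_cases hm : m = l
      · have : (M i m) = MvPolynomial.C (c i) := by
          simp only [hM, borderedMatrix, Matrix.of_apply, hlv, hi, hm, if_true, if_false]
        rw [this, MvPolynomial.totalDegree_C]
        exact Nat.zero_le _
      · rw [if_pos ⟨hi, hm⟩]
        have : M i m = if (m : ℕ) < i then MvPolynomial.C ((i : ℕ).choose m : ℂ) *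
            parityCoeff (MvPolynomial.X 0) (MvPolynomial.X 1) i m
            else if (m : ℕ) = i then MvPolynomial.X 0 + MvPolynomial.C (-2 ^ (i : ℕ)) else 0 := by
          simp only [hM, borderedMatrix, Matrix.of_apply, hlv, hi, hm, if_false]
          have h2 : (MvPolynomial.C 2 : MvPolynomial (Fin 2) ℂ) = 2 := map_ofNat _ 2
          split_ifs <;> simp [sub_eq_add_neg, h2]
        rw [this]
        split_ifs
        · refine (MvPolynomial.totalDegree_mul _ _).trans ?_
          rw [MvPolynomial.totalDegree_C, zero_add, parityCoeff]
          split_ifs <;> rw [MvPolynomial.totalDegree_X]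
        · refine (MvPolynomial.totalDegree_add _ _).trans ?_
          rw [MvPolynomial.totalDegree_C, MvPolynomial.totalDegree_X]
          simp
        · simp
  rw [Matrix.det_apply]
  refine MvPolynomial.totalDegree_finsetSum_le fun σ _ => ?_
  by_cases hσ : σ l = l
  · have : ∏ i, M (σ i) i = 0 := Finset.prod_eq_zero (Finset.mem_univ l) (by
      rw [hσ]
      simp [hM, borderedMatrix, hl])
    rw [this]
    simp
  · have h1 : (∏ i, M (σ i) i).totalDegree ≤ N := by
      refine (MvPolynomial.totalDegree_finsetProd _ _).trans ?_
      refine (Finset.sum_le_sum fun i _ => hdeg (σ i) i).trans ?_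
      rw [Finset.sum_boole, Nat.cast_id]
      have hsub : (Finset.univ.filter fun i => σ i ≠ l ∧ i ≠ l) ⊆
          (Finset.univ.erase l).erase (σ.symm l) := fun i hi => by
        rw [Finset.mem_filter] at hi
        rw [Finset.mem_erase, Finset.mem_erase]
        exact ⟨fun h => hi.2.1 (by rw [h, Equiv.apply_symm_apply]), hi.2.2, Finset.mem_univ _⟩
      refine (Finset.card_le_card hsub).trans ?_
      rw [Finset.card_erase_of_mem, Finset.card_erase_of_mem (Finset.mem_univ _),
        Finset.card_univ, Fintype.card_fin]
      · omega
      · rw [Finset.mem_erase]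
        exact ⟨fun h => hσ (by rw [← h, Equiv.apply_symm_apply, h]), Finset.mem_univ _⟩
    rcases Int.units_eq_one_or (Equiv.Perm.sign σ) with h | h <;> rw [h] <;> simpa using h1

theorem det_borderedMatrix_walk {lam : ℂ} (hlam : ‖lam‖ < 1) (N : ℕ) (p : ℕ → ℂ) (φ : ℝ) :
    2 * (borderedMatrix N (lam * Complex.cos φ) (lam * (I * Complex.sin φ)) p momLast).det =
      -(∏ n ∈ Finset.range (N + 1), (lam * Complex.cos φ - 2 ^ n)) *
        ∑ m ∈ Finset.range (N + 1), p m * walkMoment lam m φ := by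
  set u := lam * Complex.cos φ with hu
  set v := lam * (I * Complex.sin φ) with hv
  set B := borderedMatrix N u v p momLast with hB
  -- The last coordinate is `2` because the inhomogeneous term of the recurrence is `2 c_k`;
  -- Cramer's rule at that coordinate leaves the triangular minor.
  set y : Fin (N + 2) → ℂ := fun m => if (m : ℕ) = N + 1 then 2 else walkMoment lam m φ with hy
  have hA : B.mulVec y =
      Pi.single (Fin.last (N + 1)) (-∑ m ∈ Finset.range (N + 1), p m * walkMoment lam m φ) := by
    funext i
    have hsum : B.mulVec y i = ∑ m : Fin (N + 1), B i m.castSucc * walkMoment lam m φ +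
        B i (Fin.last (N + 1)) * 2 := by
      rw [Matrix.mulVec, dotProduct, Fin.sum_univ_castSucc]
      congr 1
      · refine Finset.sum_congr rfl fun m _ => ?_
        have := m.2.ne
        simp [hy, this]
      · simp [hy]
    rw [hsum]
    by_cases hi : (i : ℕ) = N + 1
    · have : i = Fin.last (N + 1) := Fin.ext hi
      subst this
      rw [Pi.single_eq_same, Finset.sum_range, ← Finset.sum_neg_distrib]
      simp only [hB, borderedMatrix, Matrix.of_apply, Fin.val_last, if_true, zero_mul, add_zero]
      refine Finset.sum_congr rfl fun m _ => ?_
      have := m.2.ne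
      simp [this]
    · have hi' : i ≠ Fin.last (N + 1) := fun h => hi (by simp [h])
      rw [Pi.single_eq_of_ne hi']
      have hk : (i : ℕ) ≤ N := by have := i.2; omega
      set k := (i : ℕ) with hkd
      have h1 : ∑ m : Fin (N + 1), B i m.castSucc * walkMoment lam m φ =
          ∑ m ∈ Finset.range (N + 1), (if m < k then (k.choose m : ℂ) * parityCoeff u v k m
            else if m = k then u - 2 ^ k else 0) * walkMoment lam m φ := by
        rw [Finset.sum_range]
        refine Finset.sum_congr rfl fun m _ => ?_
        have h5 : ¬ (m : ℕ) = N + 1 := m.2.ne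
        have h6 : ¬ (i : ℕ) = N + 1 := hi
        congr 1
        simp only [hB, borderedMatrix, Matrix.of_apply, Fin.val_castSucc, h5, h6, if_false, hkd]
      have h2 : ∑ m ∈ Finset.range (N + 1), (if m < k then (k.choose m : ℂ) * parityCoeff u v k m
            else if m = k then u - 2 ^ k else 0) * walkMoment lam m φ =
          ∑ m ∈ Finset.range (k + 1), (if m < k then (k.choose m : ℂ) * parityCoeff u v k m
            else if m = k then u - 2 ^ k else 0) * walkMoment lam m φ := by
        symm
        refine Finset.sum_subset (Finset.range_subset_range.2 (by omega)) fun m _ hm => ?_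
        rw [Finset.mem_range] at hm
        rw [if_neg (by omega), if_neg (by omega), zero_mul]
      have h3 : ∑ m ∈ Finset.range k, (if m < k then (k.choose m : ℂ) * parityCoeff u v k m
            else if m = k then u - 2 ^ k else 0) * walkMoment lam m φ =
          ∑ m ∈ Finset.range k, (k.choose m : ℂ) * parityCoeff u v k m * walkMoment lam m φ :=
        Finset.sum_congr rfl fun m hm => by rw [if_pos (Finset.mem_range.1 hm)]
      have h4 : B i (Fin.last (N + 1)) = momLast k := by
        simp [hB, borderedMatrix, hi, ← hkd]
      rw [h1, h2, Finset.sum_range_succ, h3, h4, if_neg (lt_irrefl k), if_pos rfl]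
      linear_combination -walkMoment_recurrence hlam k φ
  have hd := det_mul_of_mulVec_eq_single hA (Fin.last (N + 1))
  have ht : (B.submatrix Fin.castSucc (Fin.succAbove (Fin.last (N + 1)))).det =
      ∏ n ∈ Finset.range (N + 1), (u - 2 ^ n) := by
    rw [Fin.succAbove_last, Matrix.det_of_isLowerTriangular, Finset.prod_range]
    · refine Finset.prod_congr rfl fun i _ => ?_
      have := i.2.ne
      simp [hB, borderedMatrix, this]
    · intro i m him
      have him' : (i : ℕ) < m := him
      have h1 : ¬ (m : ℕ) < i := by omega
      have h2 : ¬ (m : ℕ) = i := by omega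
      have h3 : ¬ (i : ℕ) = N + 1 := i.2.ne
      have h4 : ¬ (m : ℕ) = N + 1 := m.2.ne
      simp only [hB, borderedMatrix, Matrix.submatrix_apply, Matrix.of_apply, Fin.val_castSucc, h1,
        h2, h3, h4, if_false]
  rw [ht, Fin.val_last, ← two_mul, pow_mul, neg_one_sq, one_pow, one_mul] at hd
  have hy2 : y (Fin.last (N + 1)) = 2 := by simp [hy]
  rw [hy2] at hd
  linear_combination hd

/-! ### Partial fractions -/

theorem prod_mul_cos_sub_ne_zero {lam : ℂ} (hlam : ‖lam‖ < 1) (N : ℕ) (φ : ℝ) :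
    ∏ n ∈ Finset.range (N + 1), (lam * Complex.cos φ - 2 ^ n) ≠ 0 :=
  Finset.prod_ne_zero_iff.2 fun n _ => sub_ne_zero.2 (mul_cos_ne_two_pow hlam φ n)

theorem norm_sq_div_four_pow_lt_one {lam : ℂ} (hlam : ‖lam‖ < 1) (j : ℕ) :
    ‖lam ^ 2 / 4 ^ j‖ < 1 := by
  have h1 : ‖lam ^ 2‖ < 1 := norm_pow_lt_one hlam two_ne_zero
  rw [norm_div, norm_pow (4 : ℂ), Complex.norm_ofNat]
  exact (div_le_self (norm_nonneg _) (one_le_pow₀ (by norm_num))).trans_lt h1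

theorem sqrtJ_ne_zero {lam : ℂ} (hlam : ‖lam‖ < 1) (j : ℕ) : sqrtJ lam j ≠ 0 :=
  sqrt_one_sub_ne_zero (norm_sq_div_four_pow_lt_one hlam j)

theorem two_pow_mul_sqrtJ_sq (lam : ℂ) (j : ℕ) :
    (-(2 ^ j * sqrtJ lam j)) ^ 2 = (2 ^ j) ^ 2 - lam ^ 2 := by
  have h := sqrt_mul_self (1 - lam ^ 2 / 4 ^ j)
  have h4 : (4 : ℂ) ^ j = (2 ^ j) ^ 2 := by rw [← pow_mul, mul_comm, pow_mul]; norm_num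
  have h2 : (2 : ℂ) ^ j ≠ 0 := pow_ne_zero _ two_ne_zero
  rw [h4] at h
  rw [sqrtJ, neg_sq, mul_pow, h4, sq (Complex.sqrt _), h]
  field_simp

theorem integral_inv_mul_cos_sub {lam : ℂ} (hlam : ‖lam‖ < 1) (j : ℕ) :
    ∫ φ in (-Real.pi)..Real.pi, (lam * Complex.cos φ - 2 ^ j)⁻¹ =
      -(2 * Real.pi / (2 ^ j * sqrtJ lam j)) := by
  have h2 : (2 : ℂ) ^ j ≠ 0 := pow_ne_zero _ two_ne_zero
  have hl : ‖lam / 2 ^ j‖ < 1 := (norm_div_two_pow_le lam j).trans_lt hlam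
  have h := integral_inv_one_sub_mul_cos hl (-Real.pi)
  rw [show -Real.pi + 2 * Real.pi = Real.pi by ring] at h
  have he : ∀ φ : ℝ, (lam * Complex.cos φ - 2 ^ j)⁻¹ =
      -(2 ^ j)⁻¹ * (1 - lam / 2 ^ j * Complex.cos φ)⁻¹ := fun φ => by
    rw [← inv_neg, ← mul_inv]
    congr 1
    field_simp
    ring
  simp_rw [he]
  have h4 : (lam / 2 ^ j) ^ 2 = lam ^ 2 / 4 ^ j := by
    rw [div_pow, ← pow_mul, mul_comm j 2, pow_mul]
    norm_num
  rw [intervalIntegral.integral_const_mul, h, h4, sqrtJ]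
  field_simp

theorem two_pow_injOn (s : Finset ℕ) : Set.InjOn (fun n : ℕ => (2 : ℂ) ^ n) s := by
  intro a _ b _ h
  have h1 : (2 : ℂ) ^ a = 2 ^ b := h
  exact Nat.pow_right_injective le_rfl (by exact_mod_cast h1)

theorem degree_lt_card_range {f : Polynomial ℂ} {N : ℕ} (hf : f.natDegree ≤ N) :
    f.degree < (Finset.range (N + 1)).card := by
  rw [Finset.card_range]
  exact Polynomial.degree_le_natDegree.trans_lt (by exact_mod_cast Nat.lt_succ_iff.2 hf)

/-- Partial fractions by Lagrange interpolation at the `N + 1` nodes `2^n`, which is exact since the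
degree is at most `N`. -/
theorem eval_div_prod_eq_sum {f : Polynomial ℂ} {N : ℕ} (hf : f.natDegree ≤ N) {x : ℂ}
    (hx : ∀ n ∈ Finset.range (N + 1), x ≠ 2 ^ n) :
    f.eval x / ∏ n ∈ Finset.range (N + 1), (x - 2 ^ n) =
      ∑ j ∈ Finset.range (N + 1), f.eval (2 ^ j) /
        (∏ n ∈ (Finset.range (N + 1)).erase j, ((2 : ℂ) ^ j - 2 ^ n)) * (x - 2 ^ j)⁻¹ := by
  have h := Lagrange.eval_interpolate_not_at_node (s := Finset.range (N + 1))
    (v := fun n : ℕ => (2 : ℂ) ^ n) (fun n => f.eval (2 ^ n)) hx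
  rw [← Lagrange.eq_interpolate (two_pow_injOn _) (degree_lt_card_range hf),
    Lagrange.eval_nodal] at h
  rw [h, mul_div_cancel_left₀ _ (Finset.prod_ne_zero_iff.2 fun n hn => sub_ne_zero.2 (hx n hn))]
  refine Finset.sum_congr rfl fun j _ => ?_
  rw [Lagrange.nodalWeight, Finset.prod_inv_distrib]
  ring

theorem continuous_inv_mul_cos_sub {lam : ℂ} (hlam : ‖lam‖ < 1) (j : ℕ) :
    Continuous fun φ : ℝ => (lam * Complex.cos φ - 2 ^ j)⁻¹ :=
  Continuous.inv₀ (by fun_prop) fun φ => sub_ne_zero.2 (mul_cos_ne_two_pow hlam φ j)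

theorem integral_eval_div_prod {lam : ℂ} (hlam : ‖lam‖ < 1) {N : ℕ} {f : Polynomial ℂ}
    (hf : f.natDegree ≤ N) :
    ∫ φ in (-Real.pi)..Real.pi, f.eval (lam * Complex.cos φ) /
        ∏ n ∈ Finset.range (N + 1), (lam * Complex.cos φ - 2 ^ n) =
      -(2 * Real.pi) * ∑ j ∈ Finset.range (N + 1), f.eval (2 ^ j) / (2 ^ j * sqrtJ lam j *
        ∏ n ∈ (Finset.range (N + 1)).erase j, ((2 : ℂ) ^ j - 2 ^ n)) := by
  simp_rw [fun φ : ℝ => eval_div_prod_eq_sum hf fun n _ => mul_cos_ne_two_pow hlam φ n]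
  rw [intervalIntegral.integral_finsetSum fun j _ =>
    ((continuous_inv_mul_cos_sub hlam j).intervalIntegrable _ _).const_mul _, Finset.mul_sum]
  refine Finset.sum_congr rfl fun j _ => ?_
  rw [intervalIntegral.integral_const_mul, integral_inv_mul_cos_sub hlam]
  ring

/-- The sum is the coefficient of `x^N` in the Lagrange interpolant, which is `f` itself. -/
theorem sum_eval_div_prod_eq_zero {N : ℕ} {f : Polynomial ℂ} (hf : f.natDegree < N) :
    ∑ j ∈ Finset.range (N + 1), f.eval (2 ^ j) /
      (∏ n ∈ (Finset.range (N + 1)).erase j, ((2 : ℂ) ^ j - 2 ^ n)) = 0 := by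
  rw [← Lagrange.coeff_eq_sum (v := fun n : ℕ => (2 : ℂ) ^ n) (two_pow_injOn _)
    (degree_lt_card_range hf.le), Finset.card_range, Nat.add_sub_cancel]
  exact Polynomial.coeff_eq_zero_of_natDegree_lt hf

/-- The residue formula for rational functions of `u = λ cos φ` and `v = i λ sin φ`: the poles
`u = 2 ^ j` are taken on the branch `v = -2 ^ j √(1 - λ² / 4 ^ j)`. -/
theorem integral_monomial_div_prod {lam : ℂ} (hlam : ‖lam‖ < 1) {N a b : ℕ} (hab : a + b ≤ N) :
    ∫ φ in (-Real.pi)..Real.pi,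
        (lam * Complex.cos φ) ^ a * (lam * (I * Complex.sin φ)) ^ b /
        ∏ n ∈ Finset.range (N + 1), (lam * Complex.cos φ - 2 ^ n) =
      -(2 * Real.pi) * ∑ j ∈ Finset.range (N + 1),
        (2 ^ j) ^ a * (-(2 ^ j * sqrtJ lam j)) ^ b / (2 ^ j * sqrtJ lam j *
          ∏ n ∈ (Finset.range (N + 1)).erase j, ((2 : ℂ) ^ j - 2 ^ n)) := by
  have hv : ∀ φ : ℝ, (lam * (I * Complex.sin φ)) ^ 2 = (lam * Complex.cos φ) ^ 2 - lam ^ 2 :=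
    fun φ => by
      linear_combination lam ^ 2 * Complex.sin φ ^ 2 * I_sq - lam ^ 2 * Complex.sin_sq_add_cos_sq φ
  obtain ⟨c, rfl | rfl⟩ := Nat.even_or_odd' b
  -- Even powers of `v` are polynomials in `u`, by `v² = u² - λ²` on both the circle and the poles.
  · set f : Polynomial ℂ :=
      Polynomial.X ^ a * (Polynomial.X ^ 2 - Polynomial.C (lam ^ 2)) ^ c with hf
    have hdeg : f.natDegree ≤ N := by
      have : f.natDegree ≤ a + c * 2 := by rw [hf]; compute_degree
      omega
    have he : ∀ u v : ℂ, v ^ 2 = u ^ 2 - lam ^ 2 → u ^ a * v ^ (2 * c) = f.eval u :=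
      fun u v h => by simp [hf, pow_mul, h]
    simp_rw [fun φ : ℝ => he _ _ (hv φ), fun j => he _ _ (two_pow_mul_sqrtJ_sq lam j)]
    exact integral_eval_div_prod hlam hdeg
  · set f : Polynomial ℂ :=
      Polynomial.X ^ a * (Polynomial.X ^ 2 - Polynomial.C (lam ^ 2)) ^ c with hf
    have hdeg : f.natDegree < N := by
      have : f.natDegree ≤ a + c * 2 := by rw [hf]; compute_degree
      omega
    have he : ∀ u v : ℂ, v ^ 2 = u ^ 2 - lam ^ 2 → u ^ a * v ^ (2 * c + 1) = f.eval u * v :=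
      fun u v h => by simp [hf, pow_add, pow_mul, h, mul_assoc]
    simp_rw [fun φ : ℝ => he _ _ (hv φ), fun j => he _ _ (two_pow_mul_sqrtJ_sq lam j)]
    -- For odd powers of `v` the integrand is odd. On the right one factor `2^j s_j` cancels and the
    -- sum without it vanishes, so the choice of branch does not affect the value.
    rw [intervalIntegral_eq_zero_of_odd fun φ => ?_]
    · have h0 := sum_eval_div_prod_eq_zero hdeg
      have : ∀ j : ℕ, f.eval (2 ^ j) * -(2 ^ j * sqrtJ lam j) / (2 ^ j * sqrtJ lam j *
          ∏ n ∈ (Finset.range (N + 1)).erase j, ((2 : ℂ) ^ j - 2 ^ n)) = -(f.eval (2 ^ j) /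
          ∏ n ∈ (Finset.range (N + 1)).erase j, ((2 : ℂ) ^ j - 2 ^ n)) := fun j => by
        have h1 : 2 ^ j * sqrtJ lam j ≠ 0 :=
          mul_ne_zero (pow_ne_zero _ two_ne_zero) (sqrtJ_ne_zero hlam j)
        rw [mul_neg, neg_div, mul_comm (f.eval _), mul_div_mul_left _ _ h1]
      simp_rw [this]
      rw [Finset.sum_neg_distrib, h0, neg_zero, mul_zero]
    · push_cast
      rw [Complex.cos_neg, Complex.sin_neg]
      ring

theorem integral_mvPolynomial_div_prod {lam : ℂ} (hlam : ‖lam‖ < 1) {N : ℕ}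
    {q : MvPolynomial (Fin 2) ℂ} (hq : q.totalDegree ≤ N) :
    ∫ φ in (-Real.pi)..Real.pi,
        MvPolynomial.eval ![lam * Complex.cos φ, lam * (I * Complex.sin φ)] q /
        ∏ n ∈ Finset.range (N + 1), (lam * Complex.cos φ - 2 ^ n) =
      -(2 * Real.pi) * ∑ j ∈ Finset.range (N + 1),
        MvPolynomial.eval ![2 ^ j, -(2 ^ j * sqrtJ lam j)] q / (2 ^ j * sqrtJ lam j *
          ∏ n ∈ (Finset.range (N + 1)).erase j, ((2 : ℂ) ^ j - 2 ^ n)) := by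
  simp_rw [MvPolynomial.eval_eq', Fin.prod_univ_two, Matrix.cons_val_one,
    Matrix.cons_val_zero, Finset.sum_div]
  rw [Finset.sum_comm, intervalIntegral.integral_finsetSum fun d _ => ?_, Finset.mul_sum]
  · refine Finset.sum_congr rfl fun d hd => ?_
    have hd2 : d 0 + d 1 ≤ N := by
      have := (MvPolynomial.le_totalDegree hd).trans hq
      rwa [Finsupp.sum_fintype _ _ (fun _ => rfl), Fin.sum_univ_two] at this
    simp_rw [mul_div_assoc (q.coeff d)]
    rw [intervalIntegral.integral_const_mul, integral_monomial_div_prod hlam hd2, ← Finset.mul_sum]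
    ring
  · refine Continuous.intervalIntegrable ?_ _ _
    exact Continuous.div (by fun_prop) (by fun_prop) fun φ => prod_mul_cos_sub_ne_zero hlam N φ

/-! ### Integrals of `V P` -/

/-- Scaling the first `N + 1` columns of one matrix by `2^j` equals scaling the last row of the
other by `2^j`. -/
theorem det_borderedMatrix_node (lam : ℂ) (N j : ℕ) (p : ℕ → ℂ) :
    (borderedMatrix N (2 ^ j) (-(2 ^ j * sqrtJ lam j)) p momLast).det =
      (2 ^ j) ^ N * (momMatrix lam N j p).det := by
  have h2 : (2 : ℂ) ^ j ≠ 0 := pow_ne_zero _ two_ne_zero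
  have h : (Matrix.of fun i m : Fin (N + 2) => (if (m : ℕ) = N + 1 then 1 else (2 : ℂ) ^ j) *
      momMatrix lam N j p i m) = Matrix.of fun i m : Fin (N + 2) =>
      (if (i : ℕ) = N + 1 then (2 : ℂ) ^ j else 1) *
        borderedMatrix N (2 ^ j) (-(2 ^ j * sqrtJ lam j)) p momLast i m := by
    ext i m
    simp only [Matrix.of_apply, momMatrix, borderedMatrix, momEntry, parityCoeff]
    split_ifs <;> first | omega | (field_simp; done) | (field_simp; ring)
  have h1 := Matrix.det_mul_row (fun m : Fin (N + 2) => if (m : ℕ) = N + 1 then 1 else (2 : ℂ) ^ j)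
    (momMatrix lam N j p)
  have h3 : ∀ i : Fin (N + 1), ¬ (i : ℕ) = N + 1 := fun i => i.2.ne
  have h4 : ∏ m : Fin (N + 2), (if (m : ℕ) = N + 1 then 1 else (2 : ℂ) ^ j) = (2 ^ j) ^ (N + 1) := by
    rw [Fin.prod_univ_castSucc]
    simp [h3]
  have h5 : ∏ m : Fin (N + 2), (if (m : ℕ) = N + 1 then (2 : ℂ) ^ j else 1) = 2 ^ j := by
    rw [Fin.prod_univ_castSucc]
    simp [h3]
  rw [h, Matrix.det_mul_column, h4, h5] at h1
  refine mul_left_cancel₀ h2 ?_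
  rw [h1]
  ring

theorem momFactor_eq (lam : ℂ) {N j : ℕ} (hj : j ∈ Finset.range (N + 1)) :
    momFactor lam N j = 2 * (2 ^ j) ^ N / (2 ^ j * sqrtJ lam j *
      ∏ n ∈ (Finset.range (N + 1)).erase j, ((2 : ℂ) ^ j - 2 ^ n)) := by
  have h2 : (2 : ℂ) ^ j ≠ 0 := pow_ne_zero _ two_ne_zero
  have h : ∏ n ∈ (Finset.range (N + 1)).erase j, ((2 : ℂ) ^ j - 2 ^ n) =
      (2 ^ j) ^ N * ∏ n ∈ (Finset.range (N + 1)).erase j, (1 - (2 : ℂ) ^ n / 2 ^ j) := by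
    have hc : ((Finset.range (N + 1)).erase j).card = N := by
      rw [Finset.card_erase_of_mem hj, Finset.card_range, Nat.add_sub_cancel]
    conv_rhs => rw [← hc, ← Finset.prod_const, hc, ← Finset.prod_mul_distrib]
    refine Finset.prod_congr rfl fun n _ => ?_
    field_simp
  rw [momFactor, h, mul_left_comm, mul_comm 2 ((2 ^ j) ^ N : ℂ),
    mul_div_mul_left _ _ (pow_ne_zero N h2)]

theorem integral_returnV_mul_eval {lam : ℂ} (hlam : ‖lam‖ < 1) {N : ℕ} {P : Polynomial ℂ}
    (hP : P.natDegree ≤ N) :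
    ∫ x : ℝ, returnV lam x * P.eval (x : ℂ) ∂muI =
      ∑ j ∈ Finset.range (N + 1), momFactor lam N j * (momMatrix lam N j P.coeff).det := by
  have hPi : Integrable (fun x : ℝ => P.eval (x : ℂ)) muI :=
    integrable_muI_iff.2 ((by fun_prop : Continuous _).intervalIntegrable _ _)
  rw [integral_returnV_mul hlam (-Real.pi) hPi, show -Real.pi + 2 * Real.pi = Real.pi by ring]
  set q : MvPolynomial (Fin 2) ℂ := (borderedMatrix N (MvPolynomial.X 0) (MvPolynomial.X 1)
    (fun m => MvPolynomial.C (P.coeff m)) (fun k => MvPolynomial.C (momLast k))).det with hq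
  have hqe : ∀ u v : ℂ, MvPolynomial.eval ![u, v] q =
      (borderedMatrix N u v P.coeff momLast).det := fun u v => by
    rw [hq, map_det_borderedMatrix]
    simp
  have hW : ∀ φ : ℝ, ∫ x : ℝ, walkSeries lam φ x * P.eval (x : ℂ) ∂muI =
      -2 * (MvPolynomial.eval ![lam * Complex.cos φ, lam * (I * Complex.sin φ)] q /
        ∏ n ∈ Finset.range (N + 1), (lam * Complex.cos φ - 2 ^ n)) := fun φ => by
    have h1 : ∫ x : ℝ, walkSeries lam φ x * P.eval (x : ℂ) ∂muI =
        ∑ m ∈ Finset.range (N + 1), P.coeff m * walkMoment lam m φ := by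
      have : ∀ x : ℝ, walkSeries lam φ x * P.eval (x : ℂ) = ∑ m ∈ Finset.range (N + 1),
          P.coeff m * (walkSeries lam φ x * (x : ℂ) ^ m) := fun x => by
        rw [eval_eq_sum_of_natDegree_le hP, Finset.mul_sum]
        exact Finset.sum_congr rfl fun m _ => by ring
      simp_rw [this]
      rw [integral_finsetSum _ fun m _ =>
        (integrable_walkSeries_mul hlam φ (integrable_pow_muI m)).const_mul _]
      simp_rw [integral_const_mul]
      rfl
    rw [h1, hqe, mul_div_assoc', eq_div_iff (prod_mul_cos_sub_ne_zero hlam N φ)]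
    linear_combination det_borderedMatrix_walk hlam N P.coeff φ
  simp_rw [hW]
  rw [intervalIntegral.integral_const_mul,
    integral_mvPolynomial_div_prod hlam (totalDegree_det_borderedMatrix N P.coeff momLast)]
  have hpi : (Real.pi : ℂ) ≠ 0 := by exact_mod_cast Real.pi_ne_zero
  rw [show ∀ S : ℂ, (2 * (Real.pi : ℂ))⁻¹ * (-2 * (-(2 * Real.pi) * S)) = 2 * S from fun S => by
    field_simp, Finset.mul_sum]
  refine Finset.sum_congr rfl fun j hj => ?_
  rw [hqe, det_borderedMatrix_node, momFactor_eq lam hj]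
  ring

theorem det_momMatrix_X_pow (lam : ℂ) (N j : ℕ) :
    (momMatrix lam N j (Polynomial.X ^ N : Polynomial ℂ).coeff).det =
      (momMatrix' lam N j).det := by
  rw [det_eq_of_last_row (Fin.last N).castSucc fun m hm => ?_]
  -- The cofactor sign is odd because the surviving entry sits one column before the corner; it
  -- cancels the sign of `-p_N`.
  · have h1 : (-1 : ℂ) ^ (N + 1 + (((Fin.last N).castSucc : Fin (N + 2)) : ℕ)) = -1 := by
      rw [Fin.val_castSucc, Fin.val_last, show N + 1 + N = 2 * N + 1 by ring, pow_succ, pow_mul]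
      simp
    have h2 : momMatrix lam N j (Polynomial.X ^ N : Polynomial ℂ).coeff (Fin.last (N + 1))
        (Fin.last N).castSucc = -1 := by simp [momMatrix]
    rw [h1, h2, neg_mul_neg, one_mul, one_mul]
    congr 1
    ext i m
    refine Fin.lastCases ?_ (fun m => ?_) m
    · have h3 : (Fin.last N).castSucc.succAbove (Fin.last N) = Fin.last (N + 1) := by
        rw [Fin.succAbove_castSucc_self, Fin.succ_last]
      have := i.2.ne
      simp [momMatrix, momMatrix', h3, this]
    · have h3 : (Fin.last N).castSucc.succAbove m.castSucc = m.castSucc.castSucc :=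
        Fin.succAbove_of_castSucc_lt _ _ (by
          rw [Fin.castSucc_lt_castSucc_iff]; exact Fin.castSucc_lt_last m)
      have h4 := i.2.ne
      have h5 := m.2.ne
      have h6 : (m : ℕ) ≠ N + 1 := by have := m.2; omega
      simp [momMatrix, momMatrix', h3, h4, h5, h6]
  · have h1 : (m : ℕ) ≠ N := fun h => hm (Fin.ext (by simpa using h))
    simp [momMatrix, Polynomial.coeff_X_pow, h1]

/-! ### Resolvents of the transfer operators -/

section Resolvent

variable {X : Type*} [NormedAddCommGroup X] [NormedSpace ℂ X]

theorem isUnit_one_sub_smul [CompleteSpace X] {lam : ℂ} (hlam : ‖lam‖ < 1) {T : X →L[ℂ] X} (hT : ‖T‖ ≤ 2) :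
    IsUnit (1 - (lam / 2) • T) := by
  refine isUnit_one_sub_of_norm_lt_one ?_
  rw [norm_smul, norm_div, Complex.norm_ofNat]
  have h0 := norm_nonneg lam
  have : ‖lam‖ / 2 * ‖T‖ ≤ ‖lam‖ / 2 * 2 := by gcongr
  linarith

theorem inverse_one_sub_smul_apply {lam : ℂ} {T : X →L[ℂ] X} (hT : IsUnit (1 - (lam / 2) • T))
    (h : X) : Ring.inverse (1 - (lam / 2) • T) h -
      (lam / 2) • T (Ring.inverse (1 - (lam / 2) • T) h) = h := by
  have := congrArg (fun S : X →L[ℂ] X => S h) (Ring.mul_inverse_cancel _ hT)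
  simpa using this

theorem continuousOn_resolvent [CompleteSpace X] {lam : ℂ} (hlam : ‖lam‖ < 1) {A B : X →L[ℂ] X}
    (hT : ∀ z : ℂ, ‖z‖ = 1 → ‖z⁻¹ • A + z • B‖ ≤ 2) (h : X) :
    ContinuousOn (fun z : ℂ => Ring.inverse (1 - (lam / 2) • (z⁻¹ • A + z • B)) h)
      (Metric.sphere 0 1) := by
  intro z hz
  have hz1 : ‖z‖ = 1 := by simpa using hz
  have hz0 : z ≠ 0 := norm_pos_iff.1 (by rw [hz1]; exact one_pos)
  obtain ⟨w, hw⟩ := isUnit_one_sub_smul hlam (hT z hz1)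
  have h1 : ContinuousAt (fun z : ℂ => 1 - (lam / 2) • (z⁻¹ • A + z • B)) z := by
    fun_prop (disch := exact hz0)
  have h2 : ContinuousAt Ring.inverse (1 - (lam / 2) • (z⁻¹ • A + z • B)) := by
    rw [← hw]; exact NormedRing.inverse_continuousAt w
  have h3 : ContinuousAt (fun z : ℂ => Ring.inverse (1 - (lam / 2) • (z⁻¹ • A + z • B))) z :=
    ContinuousAt.comp (f := fun z : ℂ => 1 - (lam / 2) • (z⁻¹ • A + z • B)) h2 h1
  exact (h3.clm_apply continuousAt_const).continuousWithinAt

theorem continuousOn_two_pi_I_mul_inv :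
    ContinuousOn (fun z : ℂ => (2 * Real.pi * I * z)⁻¹) (Metric.sphere 0 1) := by
  refine ContinuousOn.inv₀ (by fun_prop) fun z hz => ?_
  have hz1 : ‖z‖ = 1 := by simpa using hz
  have hz0 : z ≠ 0 := norm_pos_iff.1 (by rw [hz1]; exact one_pos)
  exact mul_ne_zero two_pi_I_ne_zero hz0

theorem circleIntegrable_resolvent [CompleteSpace X] {lam : ℂ} (hlam : ‖lam‖ < 1) {A B : X →L[ℂ] X}
    (hT : ∀ z : ℂ, ‖z‖ = 1 → ‖z⁻¹ • A + z • B‖ ≤ 2) (h : X) :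
    CircleIntegrable (fun z : ℂ => (2 * Real.pi * I * z)⁻¹ •
      Ring.inverse (1 - (lam / 2) • (z⁻¹ • A + z • B)) h) 0 1 :=
  (continuousOn_two_pi_I_mul_inv.smul (continuousOn_resolvent hlam hT h)).circleIntegrable
    zero_le_one

/-- For `z = e^{iφ}` the form `dz/(2πiz)` is `dφ/2π`. -/
theorem circleIntegral_eq_mean (F : ℂ → ℂ) :
    ∮ z in C(0, 1), (2 * Real.pi * I * z)⁻¹ * F z =
      (2 * Real.pi : ℂ)⁻¹ * ∫ φ in (0 : ℝ)..(2 * Real.pi), F (cexp (I * φ)) := by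
  rw [circleIntegral, ← intervalIntegral.integral_const_mul]
  refine intervalIntegral.integral_congr fun φ _ => ?_
  have h1 : circleMap 0 1 φ = cexp (I * φ) := by simp [circleMap, mul_comm]
  have h2 := Complex.exp_ne_zero (I * φ)
  have hpi : (Real.pi : ℂ) ≠ 0 := by exact_mod_cast Real.pi_ne_zero
  simp only [deriv_circleMap, h1, smul_eq_mul]
  field_simp [I_ne_zero]

/-- Used with `Φ` the integral over `(-1, 1)`, to interchange integrations, and with `Φ` a point
evaluation, to pass between the Bochner and the pointwise contour integral. -/
theorem clm_circleIntegral_comm [CompleteSpace X] (Φ : X →L[ℂ] ℂ) {F : ℂ → X}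
    (hF : CircleIntegrable (fun z : ℂ => (2 * Real.pi * I * z)⁻¹ • F z) 0 1) :
    Φ (∮ z in C(0, 1), (2 * Real.pi * I * z)⁻¹ • F z) =
      ∮ z in C(0, 1), (2 * Real.pi * I * z)⁻¹ * Φ (F z) := by
  rw [circleIntegral, circleIntegral, ← Φ.intervalIntegral_comp_comm hF.out]
  simp

/-- If `K_φ` inverts `1 - λ (e ^ {-iφ} A + e ^ {iφ} B) / 2` under the functional `Φ`, then the
mean of `K_φ` is the mean of the resolvents under `Φ`. -/
theorem circleIntegral_clm_resolvent [CompleteSpace X] {lam : ℂ} (hlam : ‖lam‖ < 1) {A B : X →L[ℂ] X}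
    (hT : ∀ z : ℂ, ‖z‖ = 1 → ‖z⁻¹ • A + z • B‖ ≤ 2)
    (Φ : X →L[ℂ] ℂ) {K : ℝ → X → ℂ}
    (hK : ∀ (φ : ℝ) (g : X), K φ (g - (lam / 2) • (cexp (-(I * φ)) • A g + cexp (I * φ) • B g)) =
      Φ g) (h : X) :
    ∮ z in C(0, 1), (2 * Real.pi * I * z)⁻¹ *
        Φ (Ring.inverse (1 - (lam / 2) • (z⁻¹ • A + z • B)) h) =
      (2 * Real.pi : ℂ)⁻¹ * ∫ φ in (0 : ℝ)..(2 * Real.pi), K φ h := by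
  rw [circleIntegral_eq_mean fun z => Φ (Ring.inverse (1 - (lam / 2) • (z⁻¹ • A + z • B)) h)]
  congr 1
  refine intervalIntegral.integral_congr fun φ _ => ?_
  have hz : ‖cexp (I * φ)‖ = 1 := by rw [mul_comm, norm_exp_ofReal_mul_I]
  have hu := isUnit_one_sub_smul hlam (hT _ hz)
  have h1 := inverse_one_sub_smul_apply hu h
  have h2 := hK φ (Ring.inverse (1 - (lam / 2) • ((cexp (I * φ))⁻¹ • A + cexp (I * φ) • B)) h)
  rw [Complex.exp_neg] at h2
  simp only [add_apply, smul_apply] at h1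
  rw [h1] at h2
  exact h2.symm

end Resolvent

/-- The functional identity behind the resolvent formula, for functions on `(-1, 1)`. -/
theorem integral_walkSeries_mul_of_ae_eq {lam : ℂ} (hlam : ‖lam‖ < 1) (φ : ℝ) {f g : ℝ → ℂ}
    (hg : Integrable g muI)
    (hf : f =ᵐ[muI] fun x => g x - lam / 2 *
      (cexp (-(I * φ)) * g ((x + -1) / 2) + cexp (I * φ) * g ((x + 1) / 2))) :
    ∫ x, walkSeries lam φ x * f x ∂muI = ∫ x, g x ∂muI := by
  have hm := integrable_walkSeries_mul hlam φ (integrable_comp_affine (e := -1) (by simp) hg)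
  have hp := integrable_walkSeries_mul hlam φ (integrable_comp_affine (e := 1) (by simp) hg)
  have h1 : ∫ x, walkSeries lam φ x * f x ∂muI =
      ∫ x, (walkSeries lam φ x * g x -
        (lam / 2 * (cexp (-(I * φ)) * (walkSeries lam φ x * g ((x + -1) / 2)) +
          cexp (I * φ) * (walkSeries lam φ x * g ((x + 1) / 2))))) ∂muI := by
    refine integral_congr_ae (hf.mono fun x hx => ?_)
    simp only [hx]
    ring
  have hs : Integrable (fun x => cexp (-(I * φ)) * (walkSeries lam φ x * g ((x + -1) / 2)) +
      cexp (I * φ) * (walkSeries lam φ x * g ((x + 1) / 2))) muI :=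
    (hm.const_mul _).add (hp.const_mul _)
  rw [h1, integral_sub (integrable_walkSeries_mul hlam φ hg) (hs.const_mul _), integral_const_mul,
    integral_add (hm.const_mul _) (hp.const_mul _), integral_const_mul, integral_const_mul,
    integral_walkSeries_mul hlam φ hg]
  ring

/-! ### The spaces `L^p(-1, 1)` -/

section LpSpace

variable {p : ENNReal} [Fact (1 ≤ p)]

theorem integrable_Lp (h : Lp ℂ p muI) : Integrable h muI :=
  (Lp.memLp h).integrable Fact.out

/-- The integral as a continuous functional on `L^p(-1, 1)`. -/
def integralLp (p : ENNReal) [Fact (1 ≤ p)] : Lp ℂ p muI →L[ℂ] ℂ :=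
  LinearMap.mkContinuous
    { toFun := fun h => ∫ x, h x ∂muI
      map_add' := fun f g => by
        rw [integral_congr_ae (Lp.coeFn_add f g)]
        exact integral_add (integrable_Lp f) (integrable_Lp g)
      map_smul' := fun c f => by
        rw [integral_congr_ae (Lp.coeFn_smul c f), RingHom.id_apply]
        exact integral_smul c _ }
    -- Hölder's constant for `L^p ⊆ L^1` on a finite measure space.
    (muI Set.univ ^ (1 / (1 : ENNReal).toReal - 1 / p.toReal)).toReal
    (fun h => by
      have h1 := eLpNorm_le_eLpNorm_mul_rpow_measure_univ (μ := muI) (f := h)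
        (Fact.out : 1 ≤ p) (Lp.memLp h).1
      have hfin : muI Set.univ ^ (1 / (1 : ENNReal).toReal - 1 / p.toReal) ≠ ⊤ := by
        refine ENNReal.rpow_ne_top_of_nonneg ?_ (measure_ne_top _ _)
        rw [ENNReal.toReal_one, div_one, sub_nonneg]
        by_cases hp : p = ⊤
        · simp [hp]
        · have : 1 ≤ p.toReal := by
            rw [← ENNReal.toReal_one]
            exact ENNReal.toReal_mono hp Fact.out
          exact (div_le_one (by linarith)).2 this
      have h2 : ‖∫ x, h x ∂muI‖ ≤ (eLpNorm h 1 muI).toReal := by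
        refine (norm_integral_le_integral_norm _).trans (le_of_eq ?_)
        rw [integral_norm_eq_lintegral_enorm (Lp.memLp h).1, eLpNorm_one_eq_lintegral_enorm]
      refine h2.trans ?_
      rw [Lp.norm_def, mul_comm, ← ENNReal.toReal_mul]
      exact ENNReal.toReal_mono (ENNReal.mul_ne_top (Lp.eLpNorm_ne_top h) hfin) h1)

theorem integral_walkSeries_mul_Lp {lam : ℂ} (hlam : ‖lam‖ < 1) (φ : ℝ) (g : Lp ℂ p muI) :
    ∫ x, walkSeries lam φ x * (g - (lam / 2) •
      (cexp (-(I * φ)) • RminusLp p g + cexp (I * φ) • RplusLp p g) : Lp ℂ p muI) x ∂muI =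
      integralLp p g := by
  refine integral_walkSeries_mul_of_ae_eq hlam φ (integrable_Lp g) ?_
  filter_upwards [Lp.coeFn_sub g ((lam / 2) •
      (cexp (-(I * φ)) • RminusLp p g + cexp (I * φ) • RplusLp p g)),
    Lp.coeFn_smul (lam / 2) (cexp (-(I * φ)) • RminusLp p g + cexp (I * φ) • RplusLp p g),
    Lp.coeFn_add (cexp (-(I * φ)) • RminusLp p g) (cexp (I * φ) • RplusLp p g),
    Lp.coeFn_smul (cexp (-(I * φ))) (RminusLp p g), Lp.coeFn_smul (cexp (I * φ)) (RplusLp p g),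
    affineLp_coeFn p (-1) (by simp) g, affineLp_coeFn p 1 (by simp) g] with x h1 h2 h3 h4 h5 h6 h7
  rw [h1, Pi.sub_apply, h2, Pi.smul_apply, h3, Pi.add_apply, h4, h5, Pi.smul_apply, Pi.smul_apply,
    RminusLp, RplusLp, h6, h7]
  rfl

/-- The norm bound `2^{1/p}` built into each affine operator is `1` at `p = ∞`. -/
theorem norm_transferLp_top_le {z : ℂ} (hz : ‖z‖ = 1) : ‖transferLp ⊤ z‖ ≤ 2 := by
  have h : ∀ (e : ℝ) (he : |e| ≤ 1), ‖affineLp ⊤ e he‖ ≤ 1 := fun e he => by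
    refine (LinearMap.mkContinuous_norm_le _ ENNReal.toReal_nonneg _).trans ?_
    simp
  refine (norm_add_le _ _).trans ?_
  rw [norm_smul, norm_smul, norm_inv, hz, inv_one, one_mul, one_mul]
  have h1 := h (-1) (by simp)
  have h2 := h 1 (by simp)
  rw [RminusLp, RplusLp]
  linarith

theorem norm_sq_Lp_two (f : Lp ℂ 2 muI) : (‖f‖ : ℂ) ^ 2 = ∫ x, (‖f x‖ : ℂ) ^ 2 ∂muI := by
  have h := inner_self_eq_norm_sq_to_K (𝕜 := ℂ) f
  rw [L2.inner_def] at h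
  simp only [inner_self_eq_norm_sq_to_K] at h
  exact h.symm

/-- The two branches tile the interval, each stretching lengths by `2`. With `(a + b)² ≤ 2(a² + b²)`
this gives operator norm at most `2`, where separate bounds of `√2` would not suffice. -/
theorem norm_sq_add_norm_sq_Lp_two (f : Lp ℂ 2 muI) :
    ‖RminusLp 2 f‖ ^ 2 + ‖RplusLp 2 f‖ ^ 2 = 2 * ‖f‖ ^ 2 := by
  have hi : Integrable (fun x => (‖f x‖ : ℂ) ^ 2) muI := by
    have := L2.integrable_inner (𝕜 := ℂ) f f
    simp only [inner_self_eq_norm_sq_to_K] at this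
    exact this
  have h1 := integral_eq_halves hi
  have h2 : ∀ (e : ℝ) (he : |e| ≤ 1), ∫ x, (‖f ((x + e) / 2)‖ : ℂ) ^ 2 ∂muI =
      (‖affineLp 2 e he f‖ : ℂ) ^ 2 := fun e he => by
    rw [norm_sq_Lp_two]
    refine integral_congr_ae ((affineLp_coeFn 2 e he f).mono fun x hx => ?_)
    simp only [hx]
  rw [h2 (-1) (by simp), h2 1 (by simp), ← norm_sq_Lp_two, real_smul] at h1
  have h3 : ((‖RminusLp 2 f‖ ^ 2 + ‖RplusLp 2 f‖ ^ 2 : ℝ) : ℂ) = ((2 * ‖f‖ ^ 2 : ℝ) : ℂ) := by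
    push_cast
    rw [h1, RminusLp, RplusLp]
    push_cast
    ring
  exact_mod_cast h3

theorem norm_transferLp_two_le {z : ℂ} (hz : ‖z‖ = 1) : ‖transferLp 2 z‖ ≤ 2 := by
  refine ContinuousLinearMap.opNorm_le_bound _ zero_le_two fun f => ?_
  have h1 := norm_sq_add_norm_sq_Lp_two f
  have h2 : ‖transferLp 2 z f‖ ≤ ‖RminusLp 2 f‖ + ‖RplusLp 2 f‖ := by
    refine (norm_add_le _ _).trans (le_of_eq ?_)
    change ‖z⁻¹ • RminusLp 2 f‖ + ‖z • RplusLp 2 f‖ = _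
    rw [norm_smul, norm_smul, norm_inv, hz, inv_one, one_mul, one_mul]
  refine h2.trans (abs_le_of_sq_le_sq' ?_ (by positivity)).2
  nlinarith [sq_nonneg (‖RminusLp 2 f‖ - ‖RplusLp 2 f‖)]

theorem norm_transferLp_le (hp : p = 2 ∨ p = ⊤) {z : ℂ} (hz : ‖z‖ = 1) :
    ‖transferLp p z‖ ≤ 2 := by
  rcases hp with rfl | rfl
  · exact norm_transferLp_two_le hz
  · exact norm_transferLp_top_le hz

theorem integral_returnV_mul_Lp {lam : ℂ} (hlam : ‖lam‖ < 1) (hp : p = 2 ∨ p = ⊤)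
    (h : Lp ℂ p muI) :
    ∫ x, returnV lam x * h x ∂muI = ∮ z in C(0, 1), (2 * Real.pi * I * z)⁻¹ *
      integralLp p (Ring.inverse (1 - (lam / 2) • transferLp p z) h) := by
  have h1 := circleIntegral_clm_resolvent hlam (A := RminusLp p) (B := RplusLp p)
    (fun _ hz => norm_transferLp_le hp hz) (integralLp p)
    (K := fun φ f => ∫ x, walkSeries lam φ x * f x ∂muI)
    (fun φ g => integral_walkSeries_mul_Lp hlam φ g) h
  rw [integral_returnV_mul hlam 0 (integrable_Lp h), zero_add, ← h1]
  rfl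

end LpSpace

/-! ### The space `C([-1, 1])` -/

/-- The extension of a function on `[-1, 1]` to the line that is constant outside. -/
def extendIcc {Y : Type*} (f : Set.Icc (-1 : ℝ) 1 → Y) : ℝ → Y :=
  Set.IccExtend (by norm_num : (-1 : ℝ) ≤ 1) f

theorem extendIcc_coe {Y : Type*} (f : Set.Icc (-1 : ℝ) 1 → Y) (x : Set.Icc (-1 : ℝ) 1) :
    extendIcc f x = f x := Set.IccExtend_val _ f x

/-- Moves integrals on `[-1, 1]` to `muI`, where the functional identity lives; the endpoints are
null. -/
theorem integral_Icc_comap (f : Set.Icc (-1 : ℝ) 1 → ℂ) :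
    ∫ x : Set.Icc (-1 : ℝ) 1, f x ∂(volume.comap Subtype.val) = ∫ x, extendIcc f x ∂muI := by
  have h := integral_subtype_comap (μ := volume) (measurableSet_Icc (a := (-1 : ℝ)) (b := 1))
    (extendIcc f)
  simp only [extendIcc_coe] at h
  rw [h, integral_Icc_eq_integral_Ioo, muI]

theorem norm_extendIcc_le (h : C(Set.Icc (-1 : ℝ) 1, ℂ)) (x : ℝ) : ‖extendIcc h x‖ ≤ ‖h‖ :=
  h.norm_coe_le_norm _

theorem integrable_extendIcc (h : C(Set.Icc (-1 : ℝ) 1, ℂ)) : Integrable (extendIcc h) muI :=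
  integrable_of_bounded (Continuous.Icc_extend' h.continuous).measurable (norm_extendIcc_le h)

/-- The integral as a continuous functional on `C([-1, 1])`. -/
def integralC : C(Set.Icc (-1 : ℝ) 1, ℂ) →L[ℂ] ℂ :=
  LinearMap.mkContinuous
    { toFun := fun h => ∫ x, extendIcc h x ∂muI
      map_add' := fun f g => integral_add (integrable_extendIcc f) (integrable_extendIcc g)
      map_smul' := fun c f => integral_const_mul c _ }
    (muI.real Set.univ)
    (fun h => by
      rw [mul_comm]
      exact norm_integral_le_of_norm_le_const (Eventually.of_forall (norm_extendIcc_le h)))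

theorem integralC_apply (h : C(Set.Icc (-1 : ℝ) 1, ℂ)) :
    integralC h = ∫ x, extendIcc h x ∂muI := rfl

theorem extendIcc_affineC {e : ℝ} (he : |e| ≤ 1) (h : C(Set.Icc (-1 : ℝ) 1, ℂ)) {x : ℝ}
    (hx : x ∈ Set.Ioo (-1 : ℝ) 1) : extendIcc (affineC e he h) x = extendIcc h ((x + e) / 2) := by
  lift x to Set.Icc (-1 : ℝ) 1 using ⟨hx.1.le, hx.2.le⟩
  rw [extendIcc_coe]
  exact (extendIcc_coe h (affineIcc e he x)).symm

theorem norm_transferC_le {z : ℂ} (hz : ‖z‖ = 1) : ‖transferC z‖ ≤ 2 := by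
  refine ContinuousLinearMap.opNorm_le_bound _ zero_le_two fun f => ?_
  refine (ContinuousMap.norm_le _ (by positivity)).2 fun x => ?_
  change ‖z⁻¹ * f (affineIcc (-1) (by simp) x) + z * f (affineIcc 1 (by simp) x)‖ ≤ _
  refine (norm_add_le _ _).trans ?_
  rw [norm_mul, norm_mul, norm_inv, hz, inv_one, one_mul, one_mul, two_mul]
  exact add_le_add (f.norm_coe_le_norm _) (f.norm_coe_le_norm _)

theorem integral_walkSeries_mul_C {lam : ℂ} (hlam : ‖lam‖ < 1) (φ : ℝ)
    (g : C(Set.Icc (-1 : ℝ) 1, ℂ)) :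
    ∫ x, walkSeries lam φ x * extendIcc (g - (lam / 2) •
      (cexp (-(I * φ)) • RminusC g + cexp (I * φ) • RplusC g) : C(Set.Icc (-1 : ℝ) 1, ℂ)) x ∂muI =
      integralC g := by
  refine integral_walkSeries_mul_of_ae_eq hlam φ (integrable_extendIcc g) ?_
  filter_upwards [ae_muI_mem] with x hx
  rw [← extendIcc_affineC (by simp) g hx, ← extendIcc_affineC (by simp) g hx]
  rfl

theorem integral_returnV_mul_C {lam : ℂ} (hlam : ‖lam‖ < 1) (h : C(Set.Icc (-1 : ℝ) 1, ℂ)) :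
    ∫ x, returnV lam x * extendIcc h x ∂muI = integralC (∮ z in C(0, 1),
      (2 * Real.pi * I * z)⁻¹ • Ring.inverse (1 - (lam / 2) • transferC z) h) := by
  have h1 := circleIntegral_clm_resolvent hlam (A := RminusC) (B := RplusC)
    (fun _ hz => norm_transferC_le hz) integralC
    (K := fun φ f => ∫ x, walkSeries lam φ x * extendIcc f x ∂muI)
    (fun φ g => integral_walkSeries_mul_C hlam φ g) h
  have h2 := clm_circleIntegral_comm integralC
    (circleIntegrable_resolvent hlam (fun _ hz => norm_transferC_le hz) h)
  rw [integral_returnV_mul hlam 0 (integrable_extendIcc h), zero_add, ← h1]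
  exact h2.symm

theorem circleIntegral_resolvent_apply {lam : ℂ} (hlam : ‖lam‖ < 1)
    (h : C(Set.Icc (-1 : ℝ) 1, ℂ)) (x : Set.Icc (-1 : ℝ) 1) :
    (∮ z in C(0, 1), (2 * Real.pi * I * z)⁻¹ •
      Ring.inverse (1 - (lam / 2) • transferC z) h) x =
      ∮ z in C(0, 1), (2 * Real.pi * I * z)⁻¹ *
        (Ring.inverse (1 - (lam / 2) • transferC z) h) x := by
  have h1 := clm_circleIntegral_comm (ContinuousMap.evalCLM ℂ x)
    (circleIntegrable_resolvent hlam (fun _ hz => norm_transferC_le hz) h)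
  simp only [ContinuousMap.evalCLM_apply] at h1
  exact h1

theorem circleIntegrable_resolvent_apply {lam : ℂ} (hlam : ‖lam‖ < 1)
    (h : C(Set.Icc (-1 : ℝ) 1, ℂ)) (x : Set.Icc (-1 : ℝ) 1) :
    CircleIntegrable (fun z : ℂ => (2 * Real.pi * I * z)⁻¹ *
      (Ring.inverse (1 - (lam / 2) • transferC z) h) x) 0 1 :=
  (continuousOn_two_pi_I_mul_inv.mul ((ContinuousMap.evalCLM ℂ x).continuous.comp_continuousOn
    (continuousOn_resolvent hlam (fun _ hz => norm_transferC_le hz) h))).circleIntegrable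
    zero_le_one

end

/-! ### Assembly of the four parts -/

theorem theorem1 (lam : ℂ) (hlam : ‖lam‖ < 1) :
    -- (i) integrals of `P(V)`
    ((∀ (N : ℕ) (P : Polynomial ℂ), P.natDegree ≤ N →
        IntervalIntegrable (fun x => P.eval (returnV lam x)) volume (-1) 1 ∧
        ∫ x in (-1 : ℝ)..1, P.eval (returnV lam x) =
          2 / (∏ n ∈ Finset.Icc 1 N, Complex.sqrt (1 - lam ^ (2 * n))) *
            (powMatrix lam N P.coeff).det) ∧
      (∀ N : ℕ, ∫ x in (-1 : ℝ)..1, returnV lam x ^ N =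
          2 / (∏ n ∈ Finset.Icc 1 N, Complex.sqrt (1 - lam ^ (2 * n))) *
            (powMatrix' lam N).det) ∧
      (∀ N : ℕ, 1 ≤ N → ∫ x in (-1 : ℝ)..1, returnV lam x ^ N =
          1 / Complex.sqrt (1 - lam ^ (2 * N)) *
            (2 + ∑ n ∈ Finset.Icc 1 (N - 1), (N.choose n : ℂ) *
              (1 - Complex.sqrt (1 - lam ^ (2 * n))) * ∫ x in (-1 : ℝ)..1, returnV lam x ^ n))) ∧
    -- (ii) the operator identity on `L²` and `L^∞`
    ((∀ (p : ENNReal) [Fact (1 ≤ p)], p = 2 ∨ p = ⊤ →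
        (∀ z : ℂ, ‖z‖ = 1 → ‖transferLp p z‖ ≤ 2 ∧ IsUnit (1 - (lam / 2) • transferLp p z)) ∧
        ∀ h : Lp ℂ p muI,
          Integrable (fun x => returnV lam x * h x) muI ∧
          CircleIntegrable (fun z : ℂ => (2 * Real.pi * I * z)⁻¹ •
            Ring.inverse (1 - (lam / 2) • transferLp p z) h) 0 1 ∧
          ∫ x, returnV lam x * h x ∂muI =
            ∫ x, (∮ z in C(0, 1), (2 * Real.pi * I * z)⁻¹ •
              Ring.inverse (1 - (lam / 2) • transferLp p z) h : Lp ℂ p muI) x ∂muI ∧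
          ∫ x, returnV lam x * h x ∂muI =
            ∮ z in C(0, 1), (2 * Real.pi * I * z)⁻¹ *
              ∫ x, (Ring.inverse (1 - (lam / 2) • transferLp p z) h : Lp ℂ p muI) x ∂muI) ∧
      -- and on `C([-1, 1])`
      (∀ z : ℂ, ‖z‖ = 1 → ‖transferC z‖ ≤ 2 ∧ IsUnit (1 - (lam / 2) • transferC z)) ∧
      (∀ h : C(Set.Icc (-1 : ℝ) 1, ℂ),
        (∀ x : Set.Icc (-1 : ℝ) 1, CircleIntegrable (fun z : ℂ => (2 * Real.pi * I * z)⁻¹ *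
          (Ring.inverse (1 - (lam / 2) • transferC z) h) x) 0 1) ∧
        ∫ x : Set.Icc (-1 : ℝ) 1, returnV lam x * h x ∂(volume.comap Subtype.val) =
          ∫ x : Set.Icc (-1 : ℝ) 1, ∮ z in C(0, 1), (2 * Real.pi * I * z)⁻¹ *
            (Ring.inverse (1 - (lam / 2) • transferC z) h) x ∂(volume.comap Subtype.val))) ∧
    -- (iii) integrals of `V P`
    ((∀ (N : ℕ) (P : Polynomial ℂ), Even N → P.natDegree ≤ N →
        ∫ x in (-1 : ℝ)..1, returnV lam x * P.eval (x : ℂ) =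
          ∑ j ∈ Finset.range (N + 1), momFactor lam N j * (momMatrix lam N j P.coeff).det) ∧
      (∀ N : ℕ, Even N →
        ∫ x in (-1 : ℝ)..1, returnV lam x * (x : ℂ) ^ N =
          ∑ j ∈ Finset.range (N + 1), momFactor lam N j * (momMatrix' lam N j).det) ∧
      (∀ N : ℕ, Odd N → ∫ x in (-1 : ℝ)..1, returnV lam x * (x : ℂ) ^ N = 0)) ∧
    -- (iv) the Fourier transform of `V`
    (∀ ω : ℂ,
      (∀ φ : ℝ, Summable (fourierTerm lam φ ω)) ∧
      IntervalIntegrable (fun φ => fourierC lam φ ω) volume (-Real.pi) Real.pi ∧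
      ∫ x in (-1 : ℝ)..1, returnV lam x * Complex.cos (ω * x) =
        1 / Real.pi * ∫ φ in (-Real.pi)..Real.pi, fourierC lam φ ω ∧
      ((∀ k : ℤ, k ≠ 0 → ω ≠ k * Real.pi) → ∀ φ : ℝ,
        (∀ n : ℕ, (fourierCF lam φ ω).dens n ≠ 0) ∧
        Tendsto (fun n : ℕ => csinc ω * (fourierCF lam φ ω).convs n) atTop
          (𝓝 (fourierC lam φ ω)))) := by
  refine ⟨⟨fun N P hP => ⟨?_, ?_⟩, fun N => ?_, fun N hN => ?_⟩,
    ⟨fun p _ hp => ⟨fun z hz => ⟨norm_transferLp_le hp hz,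
        isUnit_one_sub_smul hlam (norm_transferLp_le hp hz)⟩,
      fun h => ⟨integrable_returnV_mul hlam (integrable_Lp h), ?_, ?_,
        integral_returnV_mul_Lp hlam hp h⟩⟩,
      fun z hz => ⟨norm_transferC_le hz, isUnit_one_sub_smul hlam (norm_transferC_le hz)⟩,
      fun h => ⟨circleIntegrable_resolvent_apply hlam h, ?_⟩⟩,
    ⟨fun N P _ hP => ?_, fun N _ => ?_, fun N hN => ?_⟩,
    fun ω => ⟨fun φ => summable_fourierTerm hlam φ ω,
      (continuous_fourierC hlam ω).intervalIntegrable _ _, ?_,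
      fun hω φ => ⟨fourierCF_dens_ne_zero lam φ hω, tendsto_fourierCF_convs hlam φ hω⟩⟩⟩
  · exact integrable_muI_iff.1 (integrable_eval_returnV hlam P)
  · rw [← integral_muI, integral_eval_returnV hlam hP]
  · have h := integral_eval_returnV hlam (Polynomial.natDegree_X_pow_le (R := ℂ) N)
    rw [det_powMatrix_X_pow] at h
    rw [← integral_muI, ← h]
    simp
  · simp_rw [← integral_muI]
    exact integral_returnV_pow_eq_div hlam hN
  · exact circleIntegrable_resolvent hlam (fun _ hz => norm_transferLp_le hp hz) h
  · rw [integral_returnV_mul_Lp hlam hp h]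
    exact (clm_circleIntegral_comm (integralLp p)
      (circleIntegrable_resolvent hlam (fun _ hz => norm_transferLp_le hp hz) h)).symm
  -- The pointwise contour integrals are the values of one continuous function, the `C([-1,
  -- 1])`-valued integral.
  · simp_rw [← circleIntegral_resolvent_apply hlam h]
    rw [integral_Icc_comap, integral_Icc_comap, ← integralC_apply, ← integral_returnV_mul_C hlam]
    refine integral_congr_ae (ae_muI_mem.mono fun x hx => ?_)
    lift x to Set.Icc (-1 : ℝ) 1 using ⟨hx.1.le, hx.2.le⟩
    simp only [extendIcc_coe]
  · rw [← integral_muI, integral_returnV_mul_eval hlam hP]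
  · have h := integral_returnV_mul_eval hlam (Polynomial.natDegree_X_pow_le (R := ℂ) N)
    simp_rw [det_momMatrix_X_pow] at h
    rw [← integral_muI, ← h]
    simp
  · rw [← integral_muI, integral_returnV_mul_pow_of_odd hlam hN]
  · rw [← integral_muI, integral_returnV_cos hlam]
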